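/- **Definitions.** A *global action* on a set $X$ consists of an index set $\Phi$ with a reflexive relation $\le$, groups $G_\alpha$ acting on subsets $X_\alpha\subseteq X$ $(\alpha\in\Phi)$ with $X=\bigcup_\alpha X_\alpha$, and, for $\alpha\le\beta$, a homomorphism $G_{\alpha\le\beta}:G_\alpha\to G_\beta$ with $G_{\alpha\le\alpha}=\mathrm{id}$, such that for $\alpha\le\beta$, $g\in G_\alpha$ and $x\in X_\alpha\cap X_\beta$ one has $gx\in X_\alpha\cap X_\beta$ and $gx=G_{\alpha\le\beta}(g)x$. A *local frame* is a finite family $x_0,\dots,x_p$ (repetitions allowed) contained in one orbit of some $G_\alpha$ on $X_\alpha$; a *morphism* is a map that sends local frames to local frames. A morphism $p:Y\to X$ is a *covering morphism* if for every local frame $x_0,\dots,x_n$ in $X$ and every $y_0\in p^{-1}(x_0)$ there is a unique local frame $y_0,y_1,\dots,y_n$ in $Y$ with $p(y_i)=x_i$ for all $i$. The *line action* $L$ is the set $\mathbb Z$ with index set $\mathbb Z\cup\{*\}$, where the index $n$ carries the group of order two exchanging $n$ and $n+1$ on $\{n,n+1\}$, the index $*$ carries the trivial group on $\mathbb Z$,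 and the only relations besides reflexivity are $*\le n$. Products of global actions are formed componentwise. A *path* in $X$ is a morphism $\omega:L\to X$ that is constant on some $(-\infty,a]$ and on some $[b,\infty)$; its values there are its initial and terminal points. $X$ is *connected* if any two points are the initial and terminal points of a path. For a non-constant path $\omega$ let $\mathrm{lus}(\omega)$ be the least $b$, and $\mathrm{gls}(\omega)$ the greatest $a$, as above; both are $0$ for a constant path. If $\omega'$ starts where $\omega$ ends, the composition $\omega'\omega$ is $\omega'$ if $\omega$ is constant, and otherwise is $\omega(n)$ for $n\le\mathrm{lus}(\omega)$ and $\omega'(n-\mathrm{lus}(\omega)+\mathrm{gls}(\omega'))$ for $n\ge\mathrm{lus}(\omega)$; the inverse is $\omega^{-1}(n)=\omega(\mathrm{lus}(\omega)-n+\mathrm{gls}(\omega))$. The *fundamental group* $\pi_1(X,x_0)$ is the set of loops at $x_0$ modulo homotopies $h:L\times L\to X$ (morphisms such that $h(\cdot,n)$ is independent of $n$ for all sufficiently small $n$ and for all sufficiently large $n$) all of whose rows $h(\cdot,n)$ are loops at $x_0$, with the product induced by composition, $[\omega]\circ[\tau]=[\tau\omega]$. A morphism $p$ with $p(y_0)=x_0$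 induces the homomorphism $p_*:\pi_1(Y,y_0)\to\pi_1(X,x_0)$, $[\omega]\mapsto[p\omega]$. **Theorem 4.8.** Let $X$ be a connected global action, $x_0\in X$, and let $H$ be a subgroup of $\pi_1(X,x_0)$. Let $X_H$ be the set of paths in $X$ with initial point $x_0$ modulo the equivalence relation $$\omega\sim_H\omega'\iff \omega,\omega'\text{ have the same terminal point and }[(\omega')^{-1}\omega]\in H,$$ let $\tilde x_0\in X_H$ be the class of the constant path at $x_0$, and let $p_H:X_H\to X$ send the class of a path to its terminal point, so that $p_H(\tilde x_0)=x_0$. Then there is a global action on the set $X_H$ for which $X_H$ is connected, $p_H$ is a covering morphism, and ${p_H}_*(\pi_1(X_H,\tilde x_0))=H$. -/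

import Mathlib

universe u v w u₁ v₁ w₁ u₂ v₂ w₂

/-- A global action on the set `X`: group actions `grp α` on subsets `loc α` of `X`, indexed by a type
`Idx` with a reflexive (not necessarily transitive) relation, with structure homomorphisms.
The local sets are assumed to cover `X`. -/
structure GlobalAction (X : Type u) where
  Idx : Type v
  rel : Idx → Idx → Prop
  rel_refl : ∀ α, rel α α
  grp : Idx → Type w
  group : ∀ α, Group (grp α)
  loc : Idx → Set X
  act : ∀ α, MulAction (grp α) (loc α)
  stable : ∀ {α β}, rel α β → ∀ (g : grp α) (x : loc α), (x : X) ∈ loc β → ((g • x : loc α) : X) ∈ loc β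
  hom : ∀ {α β}, rel α β → (grp α →* grp β)
  hom_smul : ∀ {α β} (h : rel α β) (g : grp α) (x : loc α) (hx : (x : X) ∈ loc β),
    ((g • x : loc α) : X) = ((hom h g • (⟨x, hx⟩ : loc β) : loc β) : X)
  hom_refl : ∀ α, hom (rel_refl α) = MonoidHom.id (grp α)
  cover : ∀ x, ∃ α, x ∈ loc α

namespace GlobalAction

attribute [instance] GlobalAction.group GlobalAction.act

variable {X : Type u} {Y : Type u₁}

/-! Local frames and morphisms. -/

/-- The finite family `x₀, …, x_p` is a local frame at `α`. Repetitions are allowed, so that this is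
a property of the set `{x₀, …, x_p}`. -/
def IsFrameAt (A : GlobalAction.{u, v, w} X) (α : A.Idx) {p : ℕ} (x : Fin (p + 1) → X) : Prop :=
  ∃ h : ∀ i, x i ∈ A.loc α, ∀ i, ∃ g : A.grp α, g • (⟨x 0, h 0⟩ : A.loc α) = ⟨x i, h i⟩

/-- A local frame. -/
def IsLocalFrame (A : GlobalAction.{u, v, w} X) {p : ℕ} (x : Fin (p + 1) → X) : Prop :=
  ∃ α, A.IsFrameAt α x

/-- Morphisms are the functions that preserve local frames. -/
def IsMorphism (A : GlobalAction.{u, v, w} X) (B : GlobalAction.{u₁, v₁, w₁} Y) (f : X → Y) : Prop :=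
  ∀ (p : ℕ) (x : Fin (p + 1) → X), A.IsLocalFrame x → B.IsLocalFrame (fun i => f (x i))

/-- A covering morphism: local frames lift uniquely, once the lift of the first point is given. -/
def IsCovering (B : GlobalAction.{u₁, v₁, w₁} Y) (A : GlobalAction.{u, v, w} X) (p : Y → X) : Prop :=
  IsMorphism B A p ∧
    ∀ (n : ℕ) (x : Fin (n + 1) → X), A.IsLocalFrame x → ∀ y₀ : Y, p y₀ = x 0 →
      ∃! y : Fin (n + 1) → Y, y 0 = y₀ ∧ B.IsLocalFrame y ∧ ∀ i, p (y i) = x i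

/-- The product of two global actions. -/
def prod (A : GlobalAction.{u, v, w} X) (B : GlobalAction.{u₁, v₁, w₁} Y) :
    GlobalAction.{max u u₁, max v v₁, max w w₁} (X × Y) where
  Idx := A.Idx × B.Idx
  rel a b := A.rel a.1 b.1 ∧ B.rel a.2 b.2
  rel_refl a := ⟨A.rel_refl _, B.rel_refl _⟩
  grp a := A.grp a.1 × B.grp a.2
  group _ := inferInstance
  loc a := {z | z.1 ∈ A.loc a.1 ∧ z.2 ∈ B.loc a.2}
  act a :=
    { smul := fun g z => ⟨((g.1 • (⟨z.1.1, z.2.1⟩ : A.loc a.1) : A.loc a.1),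
        (g.2 • (⟨z.1.2, z.2.2⟩ : B.loc a.2) : B.loc a.2)), Subtype.prop _, Subtype.prop _⟩
      one_smul := fun z => Subtype.ext (Prod.ext
        (congrArg Subtype.val (one_smul (A.grp a.1) (⟨z.1.1, z.2.1⟩ : A.loc a.1)))
        (congrArg Subtype.val (one_smul (B.grp a.2) (⟨z.1.2, z.2.2⟩ : B.loc a.2))))
      mul_smul := fun g h z => Subtype.ext (Prod.ext
        (congrArg Subtype.val (mul_smul g.1 h.1 (⟨z.1.1, z.2.1⟩ : A.loc a.1)))
        (congrArg Subtype.val (mul_smul g.2 h.2 (⟨z.1.2, z.2.2⟩ : B.loc a.2)))) }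
  stable h g z hz := ⟨A.stable h.1 g.1 ⟨z.1.1, z.2.1⟩ hz.1, B.stable h.2 g.2 ⟨z.1.2, z.2.2⟩ hz.2⟩
  hom h := MonoidHom.prodMap (A.hom h.1) (B.hom h.2)
  hom_smul h g z hz := Prod.ext (A.hom_smul h.1 g.1 ⟨z.1.1, z.2.1⟩ hz.1)
    (B.hom_smul h.2 g.2 ⟨z.1.2, z.2.2⟩ hz.2)
  hom_refl a := by
    ext g
    · exact DFunLike.congr_fun (A.hom_refl a.1) g.1
    · exact DFunLike.congr_fun (B.hom_refl a.2) g.2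
  cover z := by
    obtain ⟨α, hα⟩ := A.cover z.1
    obtain ⟨β, hβ⟩ := B.cover z.2
    exact ⟨(α, β), hα, hβ⟩

/-- Local sets of the line action: `{n, n + 1}` for the index `n`, and `ℤ` for the index `* = none`. -/
def lineLoc : Option ℤ → Set ℤ
  | none => Set.univ
  | some n => {n, n + 1}

/-- Local groups of the line action: trivial at `*`, and at `n` the group of order two of all
permutations of `{n, n + 1}`. -/
def lineGrp : ∀ a : Option ℤ, Subgroup (Equiv.Perm (lineLoc a))
  | none => ⊥
  | some _ => ⊤

theorem lineGrp_none_smul (a : Option ℤ) (ha : a = none) (g : lineGrp a) (x : lineLoc a) : g • x = x := by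
  subst ha
  have hg : g = 1 := Subtype.ext (Subgroup.mem_bot.1 g.2)
  rw [hg, one_smul]

/-- The line action `L` on `ℤ`; the only relations are `* ≤ n` and `a ≤ a`. -/
def line : GlobalAction.{0, 0, 0} ℤ where
  Idx := Option ℤ
  rel a b := a = b ∨ a = none
  rel_refl _ := Or.inl rfl
  grp a := lineGrp a
  group _ := inferInstance
  loc := lineLoc
  act _ := inferInstance
  stable := by
    rintro α β (rfl | h) g x hx
    · exact Subtype.prop _
    · rw [lineGrp_none_smul α h g x]
      exact hx
  hom {α β} _ := if h : α = β then h ▸ MonoidHom.id _ else 1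
  hom_smul := by
    intro α β h g x hx
    by_cases hab : α = β
    · subst hab
      simp
    · have hn : α = none := h.resolve_left hab
      rw [lineGrp_none_smul α hn g x]
      simp [hab]
  hom_refl α := by simp
  cover n := ⟨none, trivial⟩

/-! Elementary facts on local frames, used to see that the constructions below are well defined. -/

theorem isLocalFrame_iff (A : GlobalAction.{u, v, w} X) {p : ℕ} (x : Fin (p + 1) → X) :
    A.IsLocalFrame x ↔ ∃ (α : A.Idx) (z : A.loc α), ∀ i, ∃ g : A.grp α, ((g • z : A.loc α) : X) = x i := by
  constructor
  · rintro ⟨α, h, H⟩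
    refine ⟨α, ⟨x 0, h 0⟩, fun i => ?_⟩
    obtain ⟨g, hg⟩ := H i
    exact ⟨g, by rw [hg]⟩
  · rintro ⟨α, z, H⟩
    choose g hg using H
    have hm : ∀ i, x i ∈ A.loc α := fun i => hg i ▸ Subtype.prop _
    have e : ∀ i, (⟨x i, hm i⟩ : A.loc α) = g i • z := fun i => Subtype.ext (hg i).symm
    refine ⟨α, hm, fun i => ⟨g i * (g 0)⁻¹, ?_⟩⟩
    rw [e, e, mul_smul, inv_smul_smul]

theorem IsLocalFrame.sub {A : GlobalAction.{u, v, w} X} {p q : ℕ} {x : Fin (p + 1) → X}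
    (hx : A.IsLocalFrame x) (y : Fin (q + 1) → X) (h : ∀ j, ∃ i, y j = x i) : A.IsLocalFrame y := by
  rw [isLocalFrame_iff] at hx ⊢
  obtain ⟨α, z, H⟩ := hx
  refine ⟨α, z, fun j => ?_⟩
  obtain ⟨i, hi⟩ := h j
  rw [hi]
  exact H i

theorem IsMorphism.comp {Z : Type u₂} {A : GlobalAction.{u, v, w} X} {B : GlobalAction.{u₁, v₁, w₁} Y}
    {C : GlobalAction.{u₂, v₂, w₂} Z} {g : Y → Z} {f : X → Y} (hg : IsMorphism B C g)
    (hf : IsMorphism A B f) : IsMorphism A C (fun x => g (f x)) :=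
  fun p x hx => hg p _ (hf p x hx)

theorem line_frame (n : ℤ) : line.IsLocalFrame ![n, n + 1] := by
  have h0 : n ∈ lineLoc (some n) := Or.inl rfl
  have h1 : n + 1 ∈ lineLoc (some n) := Or.inr rfl
  rw [isLocalFrame_iff]
  refine ⟨some n, ⟨n, h0⟩, fun i => ?_⟩
  fin_cases i
  · exact ⟨(1 : lineGrp (some n)), rfl⟩
  · refine ⟨(⟨Equiv.swap ⟨n, h0⟩ ⟨n + 1, h1⟩, Subgroup.mem_top _⟩ : lineGrp (some n)), ?_⟩
    change ((Equiv.swap (⟨n, h0⟩ : lineLoc (some n)) ⟨n + 1, h1⟩ ⟨n, h0⟩ : lineLoc (some n)) : ℤ) = n + 1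
    rw [Equiv.swap_apply_left]

theorem line_orbit (a : Option ℤ) (z : lineLoc a) :
    ∃ n : ℤ, ∀ g : lineGrp a, ((g • z : lineLoc a) : ℤ) = n ∨ ((g • z : lineLoc a) : ℤ) = n + 1 := by
  cases a with
  | none => exact ⟨z, fun g => Or.inl (by rw [lineGrp_none_smul none rfl g z])⟩
  | some n => exact ⟨n, fun g => (g • z).2⟩

theorem line_prod_frame (m n : ℤ) :
    (prod line line).IsLocalFrame ![(m, n), (m + 1, n), (m, n + 1), (m + 1, n + 1)] := by
  obtain ⟨α, z, hz⟩ := (isLocalFrame_iff _ _).1 (line_frame m)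
  obtain ⟨β, t, ht⟩ := (isLocalFrame_iff _ _).1 (line_frame n)
  obtain ⟨g0, hg0⟩ := hz 0
  obtain ⟨g1, hg1⟩ := hz 1
  obtain ⟨k0, hk0⟩ := ht 0
  obtain ⟨k1, hk1⟩ := ht 1
  rw [isLocalFrame_iff]
  refine ⟨(α, β), ⟨(z, t), z.2, t.2⟩, fun i => ?_⟩
  fin_cases i
  · exact ⟨(g0, k0), Prod.ext hg0 hk0⟩
  · exact ⟨(g1, k0), Prod.ext hg1 hk0⟩
  · exact ⟨(g0, k1), Prod.ext hg0 hk1⟩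
  · exact ⟨(g1, k1), Prod.ext hg1 hk1⟩

theorem isMorphism_line_iff (A : GlobalAction.{u, v, w} X) (f : ℤ → X) :
    IsMorphism line A f ↔ ∀ n, A.IsLocalFrame ![f n, f (n + 1)] := by
  constructor
  · intro h n
    refine (h 1 _ (line_frame n)).sub _ fun j => ⟨j, ?_⟩
    fin_cases j <;> rfl
  · intro h p x hx
    obtain ⟨α, z, H⟩ := (isLocalFrame_iff _ _).1 hx
    obtain ⟨n, hn⟩ := line_orbit α z
    refine (h n).sub _ fun j => ?_
    obtain ⟨g, hg⟩ := H j
    rcases hn g with e | e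
    · exact ⟨0, by rw [← hg]; exact congrArg f e⟩
    · exact ⟨1, by rw [← hg]; exact congrArg f e⟩

theorem isMorphism_line_prod_iff (A : GlobalAction.{u, v, w} X) (f : ℤ × ℤ → X) :
    IsMorphism (prod line line) A f ↔
      ∀ m n, A.IsLocalFrame ![f (m, n), f (m + 1, n), f (m, n + 1), f (m + 1, n + 1)] := by
  constructor
  · intro h m n
    refine (h 3 _ (line_prod_frame m n)).sub _ fun j => ⟨j, ?_⟩
    fin_cases j <;> rfl
  · intro h p x hx
    obtain ⟨⟨α, β⟩, ⟨⟨z, t⟩, hz, ht⟩, H⟩ := (isLocalFrame_iff _ _).1 hx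
    obtain ⟨m, hm⟩ := line_orbit α ⟨z, hz⟩
    obtain ⟨n, hn⟩ := line_orbit β ⟨t, ht⟩
    refine (h m n).sub _ fun j => ?_
    obtain ⟨⟨g, k⟩, hg⟩ := H j
    rw [← hg]
    rcases hm g with e | e <;> rcases hn k with e' | e'
    · exact ⟨0, congrArg f (Prod.ext e e')⟩
    · exact ⟨2, congrArg f (Prod.ext e e')⟩
    · exact ⟨1, congrArg f (Prod.ext e e')⟩
    · exact ⟨3, congrArg f (Prod.ext e e')⟩

theorem isLocalFrame_const (A : GlobalAction.{u, v, w} X) {p : ℕ} (x : X) :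
    A.IsLocalFrame (fun _ : Fin (p + 1) => x) := by
  obtain ⟨α, hα⟩ := A.cover x
  exact (isLocalFrame_iff _ _).2 ⟨α, ⟨x, hα⟩, fun _ => ⟨1, by rw [one_smul]⟩⟩

/-! Paths. -/

/-- A path: a morphism from the line action that stabilizes on the left and on the right. -/
structure Path (A : GlobalAction.{u, v, w} X) where
  toFun : ℤ → X
  isMorphism : IsMorphism line A toFun
  stabLeft : ∃ a : ℤ, ∀ n ≤ a, toFun n = toFun a
  stabRight : ∃ b : ℤ, ∀ n ≥ b, toFun n = toFun b

instance (A : GlobalAction.{u, v, w} X) : CoeFun A.Path (fun _ => ℤ → X) := ⟨Path.toFun⟩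

namespace Path

variable {A : GlobalAction.{u, v, w} X}

@[ext] theorem ext {ω τ : A.Path} (h : ∀ n, ω n = τ n) : ω = τ := by
  cases ω; cases τ; congr; exact funext h

def IsConst (ω : A.Path) : Prop := ∀ m n, ω m = ω n

open Classical in
/-- Least upper stabilization; `0` for a constant path. -/
noncomputable def lus (ω : A.Path) : ℤ := if ω.IsConst then 0 else sInf {b | ∀ n ≥ b, ω n = ω b}

open Classical in
/-- Greatest lower stabilization; `0` for a constant path. -/
noncomputable def gls (ω : A.Path) : ℤ := if ω.IsConst then 0 else sSup {a | ∀ n ≤ a, ω n = ω a}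

/-- Initial point. -/
noncomputable def init (ω : A.Path) : X := ω ω.gls

/-- Terminal point. -/
noncomputable def term (ω : A.Path) : X := ω ω.lus

theorem eq_term (ω : A.Path) {n : ℤ} (hn : ω.lus ≤ n) : ω n = ω.term := by
  unfold term
  by_cases hc : ω.IsConst
  · exact hc _ _
  · have hne : {b | ∀ n ≥ b, ω n = ω b}.Nonempty := ω.stabRight
    have hbd : BddBelow {b | ∀ n ≥ b, ω n = ω b} := by
      by_contra hb
      rw [not_bddBelow_iff] at hb
      refine hc fun m k => ?_
      obtain ⟨b, hb1, hb2⟩ := hb (min m k)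
      rw [hb1 m (by omega), hb1 k (by omega)]
    have := Int.csInf_mem hne hbd
    simp only [lus, hc, if_false] at hn ⊢
    exact this n hn

theorem eq_init (ω : A.Path) {n : ℤ} (hn : n ≤ ω.gls) : ω n = ω.init := by
  unfold init
  by_cases hc : ω.IsConst
  · exact hc _ _
  · have hne : {a | ∀ n ≤ a, ω n = ω a}.Nonempty := ω.stabLeft
    have hbd : BddAbove {a | ∀ n ≤ a, ω n = ω a} := by
      by_contra hb
      rw [not_bddAbove_iff] at hb
      refine hc fun m k => ?_
      obtain ⟨b, hb1, hb2⟩ := hb (max m k)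
      rw [hb1 m (by omega), hb1 k (by omega)]
    have := Int.csSup_mem hne hbd
    simp only [gls, hc, if_false] at hn ⊢
    exact this n hn

theorem gls_le_lus (ω : A.Path) : ω.gls ≤ ω.lus := by
  by_cases hc : ω.IsConst
  · simp [gls, lus, hc]
  · by_contra hlt
    refine hc ?_
    have key : ∀ m, ω m = ω.init := by
      intro m
      rcases le_total m ω.gls with h | h
      · exact ω.eq_init h
      · rw [ω.eq_term (by omega), ← ω.eq_term (n := ω.gls) (by omega)]
        rfl
    intro m n
    rw [key m, key n]

theorem init_eq (ω : A.Path) {x : X} {a : ℤ} (h : ∀ n ≤ a, ω n = x) : ω.init = x := by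
  rw [← ω.eq_init (min_le_right a ω.gls), h _ (min_le_left _ _)]

theorem term_eq (ω : A.Path) {x : X} {b : ℤ} (h : ∀ n ≥ b, ω n = x) : ω.term = x := by
  rw [← ω.eq_term (le_max_right b ω.lus), h _ (le_max_left _ _)]

end Path

/-! Sequences of points and homotopies between them, keeping the ends fixed. This is the working
form of paths and homotopies; it is used only to see that the fundamental group is well defined. -/

/-- `f` runs from `x` to `y`. -/
def IsSeq (A : GlobalAction.{u, v, w} X) (x y : X) (f : ℤ → X) : Prop :=
  (∀ n, A.IsLocalFrame ![f n, f (n + 1)]) ∧ (∃ a, ∀ n ≤ a, f n = x) ∧ ∃ b, ∀ n ≥ b, f n = y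

/-- `H` is a homotopy with rows `H n` running from `x` to `y`, with first row `f` and last row `g`. -/
def SeqHomotopic (A : GlobalAction.{u, v, w} X) (x y : X) (f g : ℤ → X) : Prop :=
  ∃ H : ℤ → ℤ → X,
    (∀ m n, A.IsLocalFrame ![H n m, H n (m + 1), H (n + 1) m, H (n + 1) (m + 1)]) ∧
    (∃ a, ∀ n, ∀ m ≤ a, H n m = x) ∧ (∃ b, ∀ n, ∀ m ≥ b, H n m = y) ∧
    (∃ c, ∀ n ≤ c, H n = f) ∧ ∃ d, ∀ n ≥ d, H n = g

/-- `f` up to time `b`, followed by `g` from time `c` on. -/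
def glue (b c : ℤ) (f g : ℤ → X) (n : ℤ) : X := if n ≤ b then f n else g (n - b + c)

section Seq

variable {A : GlobalAction.{u, v, w} X} {x y z : X} {f g h : ℤ → X}

theorem SeqHomotopic.refl (hf : A.IsSeq x y f) : A.SeqHomotopic x y f f := by
  obtain ⟨h1, ⟨a, ha⟩, b, hb⟩ := hf
  refine ⟨fun _ => f, fun m n => ?_, ⟨a, fun _ => ha⟩, ⟨b, fun _ => hb⟩, ⟨0, fun _ _ => rfl⟩,
    ⟨0, fun _ _ => rfl⟩⟩
  refine (h1 m).sub _ fun j => ?_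
  fin_cases j
  · exact ⟨0, rfl⟩
  · exact ⟨1, rfl⟩
  · exact ⟨0, rfl⟩
  · exact ⟨1, rfl⟩

theorem SeqHomotopic.symm (hfg : A.SeqHomotopic x y f g) : A.SeqHomotopic x y g f := by
  obtain ⟨H, h1, ⟨a, ha⟩, ⟨b, hb⟩, ⟨c, hc⟩, d, hd⟩ := hfg
  refine ⟨fun n => H (-n), fun m n => ?_, ⟨a, fun _ => ha _⟩, ⟨b, fun _ => hb _⟩,
    ⟨-d, fun n hn => hd _ (by omega)⟩, ⟨-c, fun n hn => hc _ (by omega)⟩⟩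
  have e : -n = -(n + 1) + 1 := by ring
  refine (h1 m (-(n + 1))).sub _ fun j => ?_
  fin_cases j
  · exact ⟨2, congrArg (H · m) e⟩
  · exact ⟨3, congrArg (H · (m + 1)) e⟩
  · exact ⟨0, rfl⟩
  · exact ⟨1, rfl⟩

theorem SeqHomotopic.trans (hfg : A.SeqHomotopic x y f g) (hgh : A.SeqHomotopic x y g h) :
    A.SeqHomotopic x y f h := by
  obtain ⟨H, h1, ⟨a, ha⟩, ⟨b, hb⟩, ⟨c, hc⟩, d, hd⟩ := hfg
  obtain ⟨K, k1, ⟨a', ha'⟩, ⟨b', hb'⟩, ⟨c', hc'⟩, d', hd'⟩ := hgh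
  refine ⟨glue d c' H K, fun m n => ?_, ⟨min a a', fun n m hm => ?_⟩, ⟨max b b', fun n m hm => ?_⟩,
    ⟨min c d, fun n hn => ?_⟩, ⟨max (d + 1) (d' + d - c'), fun n hn => ?_⟩⟩
  · by_cases hn : n + 1 ≤ d
    · have e1 : glue d c' H K n = H n := if_pos (by omega)
      have e2 : glue d c' H K (n + 1) = H (n + 1) := if_pos hn
      rw [e1, e2]
      exact h1 m n
    · have e1 : glue d c' H K n = K (n - d + c') := by
        unfold glue
        split_ifs with h'
        · have : n = d := by omega
          rw [hd n (by omega), hc' _ (by omega)]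
        · rfl
      have e2 : glue d c' H K (n + 1) = K (n - d + c' + 1) := by
        unfold glue
        rw [if_neg hn]
        congr 1
        ring
      rw [e1, e2]
      exact k1 m _
  · unfold glue
    split_ifs
    · exact ha n m (by omega)
    · exact ha' _ m (by omega)
  · unfold glue
    split_ifs
    · exact hb n m (by omega)
    · exact hb' _ m (by omega)
  · unfold glue
    rw [if_pos (by omega)]
    exact hc n (by omega)
  · unfold glue
    rw [if_neg (by omega)]
    exact hd' _ (by omega)

theorem SeqHomotopic.isSeq_left (hfg : A.SeqHomotopic x y f g) : A.IsSeq x y f := by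
  obtain ⟨H, h1, ⟨a, ha⟩, ⟨b, hb⟩, ⟨c, hc⟩, -⟩ := hfg
  have e : H c = f := hc c le_rfl
  refine ⟨fun n => ?_, ⟨a, fun n hn => e ▸ ha c n hn⟩, ⟨b, fun n hn => e ▸ hb c n hn⟩⟩
  rw [← e]
  refine (h1 n c).sub _ fun j => ?_
  fin_cases j
  · exact ⟨0, rfl⟩
  · exact ⟨1, rfl⟩

/-- Two time changes of bounded range with the same ends give homotopic sequences. -/
theorem seqHomotopic_reparam {φ ψ : ℤ → ℤ} {a e s t : ℤ} (hf : ∀ n, A.IsLocalFrame ![f n, f (n + 1)])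
    (hφ : ∀ n, φ (n + 1) ≤ φ n + 1 ∧ φ n ≤ φ (n + 1) + 1)
    (hψ : ∀ n, ψ (n + 1) ≤ ψ n + 1 ∧ ψ n ≤ ψ (n + 1) + 1)
    (hφa : ∀ n, a ≤ φ n ∧ φ n ≤ e) (hψa : ∀ n, a ≤ ψ n ∧ ψ n ≤ e)
    (hs : ∃ N, ∀ n ≤ N, φ n = s ∧ ψ n = s) (ht : ∃ N, ∀ n ≥ N, φ n = t ∧ ψ n = t) :
    A.SeqHomotopic (f s) (f t) (fun n => f (φ n)) (fun n => f (ψ n)) := by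
  have key : ∀ {φ ψ : ℤ → ℤ}, (∀ n, φ (n + 1) ≤ φ n + 1 ∧ φ n ≤ φ (n + 1) + 1) →
      (∀ n, ψ (n + 1) ≤ ψ n + 1 ∧ ψ n ≤ ψ (n + 1) + 1) → (∀ n, a ≤ φ n ∧ φ n ≤ ψ n ∧ ψ n ≤ e) →
      (∃ N, ∀ n ≤ N, φ n = s ∧ ψ n = s) → (∃ N, ∀ n ≥ N, φ n = t ∧ ψ n = t) →
      A.SeqHomotopic (f s) (f t) (fun n => f (φ n)) (fun n => f (ψ n)) := by
    intro φ ψ hφ hψ hab ⟨N, hN⟩ ⟨M, hM⟩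
    refine ⟨fun k n => f (max (φ n) (min (ψ n) k)), fun n k => ?_, ⟨N, fun k n hn => ?_⟩,
      ⟨M, fun k n hn => ?_⟩, ⟨a, fun k hk => ?_⟩, ⟨e, fun k hk => ?_⟩⟩
    · have h1 := hφ n
      have h2 := hψ n
      have h3 := (hab n).2.1
      have h4 := (hab (n + 1)).2.1
      obtain ⟨j, hj⟩ : ∃ j : ℤ, ∀ v ∈ [max (φ n) (min (ψ n) k), max (φ (n + 1)) (min (ψ (n + 1)) k),
          max (φ n) (min (ψ n) (k + 1)), max (φ (n + 1)) (min (ψ (n + 1)) (k + 1))],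
          v = j ∨ v = j + 1 := by
        refine ⟨min (max (φ n) (min (ψ n) k)) (max (φ (n + 1)) (min (ψ (n + 1)) k)), ?_⟩
        simp only [List.mem_cons, List.not_mem_nil, or_false, forall_eq_or_imp, forall_eq]
        omega
      refine (hf j).sub _ fun i => ?_
      simp only [List.mem_cons, List.not_mem_nil, or_false, forall_eq_or_imp, forall_eq] at hj
      obtain ⟨q0, q1, q2, q3⟩ := hj
      have fin : ∀ v : ℤ, v = j ∨ v = j + 1 → ∃ i : Fin 2, f v = ![f j, f (j + 1)] i := by
        rintro v (rfl | rfl)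
        · exact ⟨0, rfl⟩
        · exact ⟨1, rfl⟩
      fin_cases i
      · exact fin _ q0
      · exact fin _ q1
      · exact fin _ q2
      · exact fin _ q3
    · have := hN n hn
      exact congrArg f (by omega)
    · have := hM n hn
      exact congrArg f (by omega)
    · funext n
      have := hab n
      exact congrArg f (by omega)
    · funext n
      have := hab n
      exact congrArg f (by omega)
  have hχ : ∀ n, max (φ (n + 1)) (ψ (n + 1)) ≤ max (φ n) (ψ n) + 1 ∧
      max (φ n) (ψ n) ≤ max (φ (n + 1)) (ψ (n + 1)) + 1 := by
    intro n
    have := hφ n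
    have := hψ n
    omega
  obtain ⟨N, hN⟩ := hs
  obtain ⟨M, hM⟩ := ht
  refine (key (ψ := fun n => max (φ n) (ψ n)) hφ hχ (fun n => ?_) ⟨N, fun n hn => ?_⟩
    ⟨M, fun n hn => ?_⟩).trans (key (ψ := fun n => max (φ n) (ψ n)) hψ hχ (fun n => ?_)
    ⟨N, fun n hn => ?_⟩ ⟨M, fun n hn => ?_⟩).symm
  · have := hφa n
    have := hψa n
    omega
  · have := hN n hn
    omega
  · have := hM n hn
    omega
  · have := hφa n
    have := hψa n
    omega
  · have := hN n hn
    omega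
  · have := hM n hn
    omega

/-- A time change that goes from `-∞` to `∞` does not change the homotopy class. -/
theorem seqHomotopic_comp {φ : ℤ → ℤ} (hf : A.IsSeq x y f)
    (hφ : ∀ n, φ (n + 1) ≤ φ n + 1 ∧ φ n ≤ φ (n + 1) + 1)
    (h0 : ∀ a, ∃ N, ∀ n ≤ N, φ n ≤ a) (h1 : ∀ a, ∃ N, ∀ n ≥ N, a ≤ φ n) :
    A.SeqHomotopic x y f (fun n => f (φ n)) := by
  obtain ⟨hf, ⟨a, ha⟩, b, hb⟩ := hf
  set e := max a b with he
  have hfe : ∀ n, f (max a (min e n)) = f n := by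
    intro n
    rcases le_total n a with h | h
    · rw [ha n h, ha _ (by omega)]
    · rcases le_total n e with h' | h'
      · congr 1
        omega
      · rw [hb n (by omega), hb _ (by omega)]
  obtain ⟨N, hN⟩ := h0 a
  obtain ⟨M, hM⟩ := h1 e
  have := seqHomotopic_reparam (φ := fun n => max a (min e n)) (ψ := fun n => max a (min e (φ n)))
    (a := a) (e := e) (s := a) (t := e) hf (fun n => by omega)
    (fun n => by have := hφ n; omega) (fun n => by omega)
    (fun n => by omega)
    ⟨min N a, fun n hn => by have := hN n (by omega); omega⟩
    ⟨max M e, fun n hn => by have := hM n (by omega); omega⟩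
  simp only [hfe] at this
  rwa [ha a le_rfl, hb e (by omega)] at this

theorem isSeq_glue {b c : ℤ} (hf : A.IsSeq x y f) (hg : A.IsSeq y z g) (hb : ∀ n ≥ b, f n = y)
    (hc : ∀ n ≤ c, g n = y) : A.IsSeq x z (glue b c f g) := by
  obtain ⟨hf1, ⟨a, ha⟩, -⟩ := hf
  obtain ⟨hg1, -, e, he⟩ := hg
  refine ⟨fun n => ?_, ⟨min a b, fun n hn => ?_⟩, ⟨max (b + 1) (e + b - c), fun n hn => ?_⟩⟩
  · by_cases hn : n + 1 ≤ b
    · have e1 : glue b c f g n = f n := if_pos (by omega)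
      have e2 : glue b c f g (n + 1) = f (n + 1) := if_pos hn
      rw [e1, e2]
      exact hf1 n
    · have e1 : glue b c f g n = g (n - b + c) := by
        unfold glue
        split_ifs with h'
        · rw [hb n (by omega), hc _ (by omega)]
        · rfl
      have e2 : glue b c f g (n + 1) = g (n - b + c + 1) := by
        unfold glue
        rw [if_neg hn]
        congr 1
        ring
      rw [e1, e2]
      exact hg1 _
  · unfold glue
    rw [if_pos (by omega)]
    exact ha n (by omega)
  · unfold glue
    rw [if_neg (by omega)]
    exact he _ (by omega)

theorem glue_indep {b c b' c' : ℤ} (hf : A.IsSeq x y f) (hg : A.IsSeq y z g) (hb : ∀ n ≥ b, f n = y)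
    (hc : ∀ n ≤ c, g n = y) (hb' : ∀ n ≥ b', f n = y) (hc' : ∀ n ≤ c', g n = y) :
    A.SeqHomotopic x z (glue b c f g) (glue b' c' f g) := by
  have key : ∀ {b c b' c' : ℤ}, (∀ n ≥ b, f n = y) → (∀ n ≤ c, g n = y) → b ≤ b' → c' ≤ c →
      A.SeqHomotopic x z (glue b c f g) (glue b' c' f g) := by
    intro b c b' c' hb hc hbb hcc
    have h1 := seqHomotopic_comp (φ := fun n => min n (max b (n - ((b' - b) + (c - c')))))
      (isSeq_glue hf hg hb hc) (fun n => by omega)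
      (fun a => ⟨a, fun n hn => by omega⟩)
      (fun a => ⟨max a (a + ((b' - b) + (c - c'))), fun n hn => by omega⟩)
    convert h1 using 1
    funext n
    unfold glue
    split_ifs with p q q
    · rcases le_total n b with r | r
      · congr 1
        omega
      · rw [hb n r, hb _ (by omega)]
    · omega
    · rw [hc _ (by omega), hb _ (by omega)]
    · congr 1
      omega
  exact (key (b' := max b b') (c' := min c c') hb hc (by omega) (by omega)).trans
    (key hb' hc' (by omega) (by omega)).symm

theorem glue_congr {f' g' : ℤ → X} (hf : A.SeqHomotopic x y f f') (hg : A.SeqHomotopic y z g g')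
    {b c b' c' : ℤ} (hb : ∀ n ≥ b, f n = y) (hc : ∀ n ≤ c, g n = y) (hb' : ∀ n ≥ b', f' n = y)
    (hc' : ∀ n ≤ c', g' n = y) : A.SeqHomotopic x z (glue b c f g) (glue b' c' f' g') := by
  have sf := hf.isSeq_left
  have sg := hg.isSeq_left
  have sf' := hf.symm.isSeq_left
  have sg' := hg.symm.isSeq_left
  obtain ⟨H, h1, ⟨r, hr⟩, ⟨B, hB⟩, ⟨c₁, hc₁⟩, d₁, hd₁⟩ := hf
  obtain ⟨K, k1, ⟨C, hC⟩, ⟨s, hs⟩, ⟨c₂, hc₂⟩, d₂, hd₂⟩ := hg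
  have mid : A.SeqHomotopic x z (glue B C f g) (glue B C f' g') := by
    refine ⟨fun n => glue B C (H n) (K n), fun m n => ?_, ⟨min r B, fun n m hm => ?_⟩,
      ⟨max (B + 1) (s + B - C), fun n m hm => ?_⟩, ⟨min c₁ c₂, fun n hn => ?_⟩,
      ⟨max d₁ d₂, fun n hn => ?_⟩⟩
    · by_cases hm : m + 1 ≤ B
      · have e1 : ∀ k, glue B C (H k) (K k) m = H k m := fun k => if_pos (by omega)
        have e2 : ∀ k, glue B C (H k) (K k) (m + 1) = H k (m + 1) := fun k => if_pos hm
        simp only [e1, e2]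
        exact h1 m n
      · have e1 : ∀ k, glue B C (H k) (K k) m = K k (m - B + C) := by
          intro k
          unfold glue
          split_ifs with h'
          · rw [hB k m (by omega), hC k _ (by omega)]
          · rfl
        have e2 : ∀ k, glue B C (H k) (K k) (m + 1) = K k (m - B + C + 1) := by
          intro k
          unfold glue
          rw [if_neg hm]
          congr 1
          ring
        simp only [e1, e2]
        exact k1 _ n
    · dsimp only [glue]
      rw [if_pos (by omega)]
      exact hr n m (by omega)
    · dsimp only [glue]
      rw [if_neg (by omega)]
      exact hs n _ (by omega)
    · dsimp only
      rw [hc₁ n (by omega), hc₂ n (by omega)]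
    · dsimp only
      rw [hd₁ n (by omega), hd₂ n (by omega)]
  have eB : ∀ n ≥ B, f n = y := fun n hn => by rw [← hc₁ c₁ le_rfl]; exact hB _ n hn
  have eC : ∀ n ≤ C, g n = y := fun n hn => by rw [← hc₂ c₂ le_rfl]; exact hC _ n hn
  have eB' : ∀ n ≥ B, f' n = y := fun n hn => by rw [← hd₁ d₁ le_rfl]; exact hB _ n hn
  have eC' : ∀ n ≤ C, g' n = y := fun n hn => by rw [← hd₂ d₂ le_rfl]; exact hC _ n hn
  exact ((glue_indep sf sg hb hc eB eC).trans mid).trans (glue_indep sf' sg' eB' eC' hb' hc')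

theorem glue_glue {b c b' c' : ℤ} (hbb : b ≤ b') : glue b' c' (glue b c f g) h = glue b c f (glue (b' - b + c) c' g h) := by
  funext n
  unfold glue
  split_ifs <;> first | rfl | omega | (congr 1; ring)

theorem glue_reverse {b c k : ℤ} (hf : A.IsSeq x y f) (hb : ∀ n ≥ b, f n = y)
    (hc : ∀ n ≤ c, f (k - n) = y) :
    A.SeqHomotopic x x (glue b c f (fun n => f (k - n))) (fun _ => x) := by
  obtain ⟨hf1, ⟨a, ha⟩, -⟩ := hf
  have h0 : A.IsSeq x y f := ⟨hf1, ⟨a, ha⟩, b, hb⟩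
  have h1 : A.IsSeq y x (fun n => f (k - n)) := by
    refine ⟨fun n => ?_, ⟨c, hc⟩, k - a, fun n hn => ha _ (by omega)⟩
    refine (hf1 (k - (n + 1))).sub _ fun j => ?_
    fin_cases j
    · exact ⟨1, congrArg f (by ring)⟩
    · exact ⟨0, rfl⟩
  refine (glue_indep (b' := max a b) (c' := k - max a b) h0 h1 hb hc (fun n hn => hb n (by omega))
    (fun n hn => hb _ (by omega))).trans ?_
  have e : glue (max a b) (k - max a b) f (fun n => f (k - n)) =
      fun n => f (max a (min n (2 * max a b - n))) := by
    funext n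
    dsimp only [glue]
    split_ifs with h'
    · rcases le_total n a with q | q
      · rw [ha n q, ha _ (by omega)]
      · congr 1
        omega
    · rcases le_total (2 * max a b - n) a with q | q
      · rw [ha _ (by omega), ha _ (by omega)]
      · congr 1
        omega
  rw [e]
  have := seqHomotopic_reparam (φ := fun n => max a (min n (2 * max a b - n))) (ψ := fun _ => a)
    (a := a) (e := max a b) (s := a) (t := a) hf1 (fun n => by omega)
    (fun n => by omega) (fun n => by omega) (fun n => by omega)
    ⟨a, fun n hn => by omega⟩ ⟨2 * max a b - a, fun n hn => by omega⟩
  rwa [ha a le_rfl] at this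

end Seq

/-! Composition and inversion of paths. -/

namespace Path

variable {A : GlobalAction.{u, v, w} X} {x y z : X}

theorem isSeq (ω : A.Path) (hx : ω.init = x) (hy : ω.term = y) : A.IsSeq x y ω :=
  ⟨(isMorphism_line_iff A _).1 ω.isMorphism, ⟨ω.gls, fun _ hn => hx ▸ ω.eq_init hn⟩,
    ⟨ω.lus, fun _ hn => hy ▸ ω.eq_term hn⟩⟩

/-- The path with a given underlying sequence of points. -/
def ofSeq (f : ℤ → X) (hf : A.IsSeq x y f) : A.Path where
  toFun := f
  isMorphism := (isMorphism_line_iff A f).2 hf.1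
  stabLeft := hf.2.1.imp fun a ha n hn => by rw [ha n hn, ha a le_rfl]
  stabRight := hf.2.2.imp fun a ha n hn => by rw [ha n hn, ha a le_rfl]

theorem init_ofSeq (f : ℤ → X) (hf : A.IsSeq x y f) : (ofSeq f hf).init = x := by
  obtain ⟨a, ha⟩ := hf.2.1
  exact init_eq _ ha

theorem term_ofSeq (f : ℤ → X) (hf : A.IsSeq x y f) : (ofSeq f hf).term = y := by
  obtain ⟨a, ha⟩ := hf.2.2
  exact term_eq _ ha

/-- The constant path. -/
def const (A : GlobalAction.{u, v, w} X) (x : X) : A.Path where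
  toFun _ := x
  isMorphism _ _ _ := isLocalFrame_const A x
  stabLeft := ⟨0, fun _ _ => rfl⟩
  stabRight := ⟨0, fun _ _ => rfl⟩

theorem init_const (A : GlobalAction.{u, v, w} X) (x : X) : (const A x).init = x := rfl

theorem term_const (A : GlobalAction.{u, v, w} X) (x : X) : (const A x).term = x := rfl

theorem IsConst.init_eq_term {ω : A.Path} (h : ω.IsConst) : ω.init = ω.term := h _ _

open Classical in
theorem isSeq_comp (ω τ : A.Path) (h : ω.term = τ.init) :
    A.IsSeq ω.init τ.term (fun n => if ω.IsConst then τ n else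
      if n ≤ ω.lus then ω n else τ (n - ω.lus + τ.gls)) := by
  by_cases hc : ω.IsConst
  · simp only [hc, if_true]
    exact τ.isSeq (by rw [← h, hc.init_eq_term]) rfl
  · simp only [hc, if_false]
    exact isSeq_glue (ω.isSeq rfl rfl) (τ.isSeq h.symm rfl) (fun _ => ω.eq_term)
      (fun n hn => h ▸ τ.eq_init hn)

open Classical in
/-- The composition of paths, first `ω` and then `τ`, usually written `τω`. -/
noncomputable def comp (ω τ : A.Path) (h : ω.term = τ.init) : A.Path :=
  ofSeq (fun n => if ω.IsConst then τ n else
    if n ≤ ω.lus then ω n else τ (n - ω.lus + τ.gls)) (isSeq_comp ω τ h)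

@[simp] theorem init_comp (ω τ : A.Path) (h : ω.term = τ.init) : (ω.comp τ h).init = ω.init :=
  init_ofSeq _ _

@[simp] theorem term_comp (ω τ : A.Path) (h : ω.term = τ.init) : (ω.comp τ h).term = τ.term :=
  term_ofSeq _ _

theorem isSeq_inv (ω : A.Path) : A.IsSeq ω.term ω.init (fun n => ω (ω.lus - n + ω.gls)) := by
  refine ⟨fun n => ?_, ⟨ω.gls, fun n hn => ω.eq_term (by omega)⟩,
    ⟨ω.lus, fun n hn => ω.eq_init (by omega)⟩⟩
  refine (((isMorphism_line_iff A _).1 ω.isMorphism) (ω.lus - (n + 1) + ω.gls)).sub _ fun j => ?_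
  fin_cases j
  · exact ⟨1, congrArg ω.toFun (by ring)⟩
  · exact ⟨0, rfl⟩

/-- The inverse path. The formula gives the terminal point of `ω` for `n < gls` and the initial point
for `n > lus`. -/
noncomputable def inv (ω : A.Path) : A.Path := ofSeq (fun n => ω (ω.lus - n + ω.gls)) ω.isSeq_inv

@[simp] theorem init_inv (ω : A.Path) : ω.inv.init = ω.term := init_ofSeq _ _

@[simp] theorem term_inv (ω : A.Path) : ω.inv.term = ω.init := term_ofSeq _ _

theorem comp_seqHomotopic {ω τ : A.Path} (h : ω.term = τ.init) (hx : ω.init = x) (hy : ω.term = y)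
    (hz : τ.term = z) {b c : ℤ} (hb : ∀ n ≥ b, ω n = y) (hc : ∀ n ≤ c, τ n = y) :
    A.SeqHomotopic x z (ω.comp τ h) (glue b c ω τ) := by
  have sω := ω.isSeq hx hy
  have sτ := τ.isSeq (h.symm.trans hy) hz
  by_cases hω : ω.IsConst
  · have e : (ω.comp τ h).toFun = τ := by
      funext n
      simp [comp, ofSeq, hω]
    have exy : x = y := by rw [← hx, ← hy, hω.init_eq_term]
    rw [e]
    have h1 := seqHomotopic_comp (φ := fun n => max (min n c) (n - b + c)) sτ (fun n => by omega)
      (fun a => ⟨min a (a + b - c), fun n hn => by omega⟩)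
      (fun a => ⟨max c (a + b - c), fun n hn => by omega⟩)
    rw [exy]
    convert h1 using 1
    funext n
    unfold glue
    split_ifs with p
    · rw [hc _ (by omega), hω n b, hb b le_rfl]
    · by_cases q : min n c ≤ n - b + c
      · rw [max_eq_right q]
      · rw [hc _ (by omega), hc _ (by omega)]
  · have e : (ω.comp τ h).toFun = glue ω.lus τ.gls ω τ := by
      funext n
      simp [comp, ofSeq, hω, glue]
    rw [e]
    exact glue_indep sω sτ (fun n hn => hy ▸ ω.eq_term hn)
      (fun n hn => hy ▸ h ▸ τ.eq_init hn) hb hc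

theorem comp_congr {ω τ ω' τ' : A.Path} (h : ω.term = τ.init) (h' : ω'.term = τ'.init)
    (hx : ω.init = x) (hy : ω.term = y) (hz : τ.term = z)
    (hx' : ω'.init = x) (hy' : ω'.term = y) (hz' : τ'.term = z)
    (H : A.SeqHomotopic x y ω ω') (K : A.SeqHomotopic y z τ τ') :
    A.SeqHomotopic x z (ω.comp τ h) (ω'.comp τ' h') := by
  have b1 : ∀ n ≥ ω.lus, ω n = y := fun n hn => hy ▸ ω.eq_term hn
  have b2 : ∀ n ≥ ω'.lus, ω' n = y := fun n hn => hy' ▸ ω'.eq_term hn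
  have c1 : ∀ n ≤ τ.gls, τ n = y := fun n hn => hy ▸ h ▸ τ.eq_init hn
  have c2 : ∀ n ≤ τ'.gls, τ' n = y := fun n hn => hy' ▸ h' ▸ τ'.eq_init hn
  exact ((comp_seqHomotopic h hx hy hz b1 c1).trans (glue_congr H K b1 c1 b2 c2)).trans
    (comp_seqHomotopic h' hx' hy' hz' b2 c2).symm

theorem comp_assoc {ω τ σ : A.Path} (h : ω.term = τ.init) (h' : τ.term = σ.init)
    (h₁ : (ω.comp τ h).term = σ.init) (h₂ : ω.term = (τ.comp σ h').init)
    (hx : ω.init = x) (hz : σ.term = z) :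
    A.SeqHomotopic x z ((ω.comp τ h).comp σ h₁) (ω.comp (τ.comp σ h') h₂) := by
  have b1 : ∀ n ≥ ω.lus, ω n = ω.term := fun n hn => ω.eq_term hn
  have b2 : ∀ n ≥ max τ.lus τ.gls, τ n = τ.term := fun n hn => τ.eq_term (by omega)
  have c1 : ∀ n ≤ τ.gls, τ n = ω.term := fun n hn => h ▸ τ.eq_init hn
  have c2 : ∀ n ≤ σ.gls, σ n = τ.term := fun n hn => h' ▸ σ.eq_init hn
  have hωτ := comp_seqHomotopic h hx rfl rfl b1 c1
  have hτσ := comp_seqHomotopic h' h.symm rfl hz b2 c2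
  have sσ := σ.isSeq h'.symm hz
  set B := max τ.lus τ.gls with hB
  set B' := ω.lus + B - τ.gls with hB'
  have b3 : ∀ n ≥ B', glue ω.lus τ.gls ω τ n = τ.term := by
    intro n hn
    unfold glue
    split_ifs with q
    · rw [b1 n (by omega), ← c1 τ.gls le_rfl, b2 _ (by omega)]
    · exact b2 _ (by omega)
  have c3 : ∀ n ≤ τ.gls, glue B σ.gls τ σ n = ω.term := by
    intro n hn
    unfold glue
    rw [if_pos (by omega)]
    exact c1 n hn
  have e1 := comp_seqHomotopic h₁ ((init_comp _ _ h).trans hx) (term_comp _ _ h) hz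
    (fun n hn => (term_comp _ _ h) ▸ (ω.comp τ h).eq_term hn) c2
  have e2 := comp_seqHomotopic h₂ hx rfl ((term_comp _ _ h').trans hz) b1
    (fun n hn => h₂ ▸ (τ.comp σ h').eq_init hn)
  refine (e1.trans (glue_congr hωτ (SeqHomotopic.refl sσ) (fun n hn => (term_comp _ _ h) ▸
    (ω.comp τ h).eq_term hn) c2 b3 c2)).trans (SeqHomotopic.trans ?_ (e2.trans
    (glue_congr (SeqHomotopic.refl (ω.isSeq hx rfl)) hτσ b1 (fun n hn => h₂ ▸
    (τ.comp σ h').eq_init hn) b1 c3)).symm)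
  rw [glue_glue (by omega)]
  have e3 : B' - ω.lus + τ.gls = B := by omega
  rw [e3]
  exact SeqHomotopic.refl (isSeq_glue (ω.isSeq hx rfl)
    (isSeq_glue (τ.isSeq h.symm rfl) sσ b2 c2) b1 c3)

theorem comp_inv (ω : A.Path) (h : ω.term = ω.inv.init) (hx : ω.init = x) :
    A.SeqHomotopic x x (ω.comp ω.inv h) (const A x) := by
  have b1 : ∀ n ≥ ω.lus, ω n = ω.term := fun n hn => ω.eq_term hn
  have c1 : ∀ n ≤ ω.inv.gls, ω.inv n = ω.term := fun n hn => h ▸ ω.inv.eq_init hn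
  have e : ω.inv.toFun = fun n => ω (ω.lus + ω.gls - n) := by
    funext n
    exact congrArg ω.toFun (by ring)
  refine (comp_seqHomotopic h hx rfl (ω.term_inv.trans hx) b1 c1).trans ?_
  rw [e] at c1 ⊢
  exact glue_reverse (ω.isSeq hx rfl) b1 c1

theorem inv_comp (ω : A.Path) (h : ω.inv.term = ω.init) (hx : ω.term = x) :
    A.SeqHomotopic x x (ω.inv.comp ω h) (const A x) := by
  have b1 : ∀ n ≥ ω.inv.lus, ω.inv n = ω.init := fun n hn => h ▸ ω.inv.eq_term hn
  have c1 : ∀ n ≤ ω.gls, ω n = ω.init := fun n hn => ω.eq_init hn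
  have e : ω.toFun = fun n => ω.inv (ω.lus + ω.gls - n) := by
    funext n
    exact congrArg ω.toFun (by ring)
  refine (comp_seqHomotopic h (ω.init_inv.trans hx) h hx b1 c1).trans ?_
  rw [e] at c1 ⊢
  exact glue_reverse (ω.inv.isSeq (ω.init_inv.trans hx) h) b1 c1

theorem const_comp {ω τ : A.Path} (h : ω.term = τ.init) (hω : ω.IsConst) : ω.comp τ h = τ := by
  ext n
  simp [comp, ofSeq, hω]

theorem comp_const {ω : A.Path} (h : ω.term = (const A y).init) (hx : ω.init = x) (hy : ω.term = y) :
    A.SeqHomotopic x y (ω.comp (const A y) h) ω := by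
  have b1 : ∀ n ≥ ω.lus, ω n = y := fun n hn => hy ▸ ω.eq_term hn
  refine (comp_seqHomotopic (c := 0) h hx hy rfl b1 (fun _ _ => rfl)).trans ?_
  have e : glue ω.lus 0 ω (const A y) = ω := by
    funext n
    unfold glue
    split_ifs with q
    · rfl
    · exact (b1 n (by omega)).symm
  rw [e]
  exact SeqHomotopic.refl (ω.isSeq hx hy)

/-- The image of a path under a morphism. -/
def map {B : GlobalAction.{u₁, v₁, w₁} Y} {p : X → Y} (hp : IsMorphism A B p) (ω : A.Path) : B.Path where
  toFun n := p (ω n)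
  isMorphism := hp.comp ω.isMorphism
  stabLeft := ω.stabLeft.imp fun _ ha n hn => congrArg p (ha n hn)
  stabRight := ω.stabRight.imp fun _ ha n hn => congrArg p (ha n hn)

theorem init_map {B : GlobalAction.{u₁, v₁, w₁} Y} {p : X → Y} (hp : IsMorphism A B p) (ω : A.Path) :
    (ω.map hp).init = p ω.init :=
  init_eq _ fun _ hn => congrArg p (ω.eq_init hn)

theorem term_map {B : GlobalAction.{u₁, v₁, w₁} Y} {p : X → Y} (hp : IsMorphism A B p) (ω : A.Path) :
    (ω.map hp).term = p ω.term :=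
  term_eq _ fun _ hn => congrArg p (ω.eq_term hn)

end Path

/-- A global action is connected if any two points are joined by a path. -/
def IsConnected (A : GlobalAction.{u, v, w} X) : Prop :=
  ∀ x y : X, ∃ ω : A.Path, ω.init = x ∧ ω.term = y

/-! Loops, homotopies and the fundamental group. -/

/-- Loops at `x`. -/
def Loop (A : GlobalAction.{u, v, w} X) (x : X) : Type u := {ω : A.Path // ω.init = x ∧ ω.term = x}

/-- A homotopy: a morphism `X × L → Y` whose values `H (·, n)` stabilize on the left and on the right. -/
def IsHomotopy (A : GlobalAction.{u, v, w} X) (B : GlobalAction.{u₁, v₁, w₁} Y) (H : X × ℤ → Y) : Prop :=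
  IsMorphism (prod A line) B H ∧ ∃ n₁ n₂ : ℤ, n₁ ≤ n₂ ∧
    (∀ n ≥ n₂, ∀ x, H (x, n) = H (x, n₂)) ∧ ∀ n ≤ n₁, ∀ x, H (x, n) = H (x, n₁)

/-- End point stable homotopy of loops at `x`: a homotopy `H : L × L → X` all of whose rows `H (·, n)`
are loops at `x`, with row `ω` for all small `n` and row `τ` for all large `n`. -/
def LoopHomotopic (A : GlobalAction.{u, v, w} X) (x : X) (ω τ : A.Loop x) : Prop :=
  ∃ H : ℤ × ℤ → X, IsHomotopy line A H ∧
    (∀ n, ∃ σ : A.Loop x, ∀ m, H (m, n) = σ.1 m) ∧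
    (∃ N : ℤ, ∀ n ≤ N, ∀ m, H (m, n) = ω.1 m) ∧ ∃ N : ℤ, ∀ n ≥ N, ∀ m, H (m, n) = τ.1 m

theorem loopHomotopic_iff (A : GlobalAction.{u, v, w} X) (x : X) (ω τ : A.Loop x) :
    A.LoopHomotopic x ω τ ↔ A.SeqHomotopic x x ω.1 τ.1 := by
  constructor
  · rintro ⟨H, ⟨hm, n₁, n₂, -, h2, h1⟩, hl, ⟨c, hc⟩, d, hd⟩
    have hrow : ∀ n, ∃ a b, (∀ m ≤ a, H (m, n) = x) ∧ ∀ m ≥ b, H (m, n) = x := by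
      intro n
      obtain ⟨σ, hσ⟩ := hl n
      exact ⟨σ.1.gls, σ.1.lus, fun m hm => by rw [hσ, σ.1.eq_init hm, σ.2.1],
        fun m hm => by rw [hσ, σ.1.eq_term hm, σ.2.2]⟩
    choose a b ha hb using hrow
    obtain ⟨M, hM⟩ := ((Finset.Icc n₁ n₂).image a).bddBelow
    obtain ⟨N, hN⟩ := ((Finset.Icc n₁ n₂).image b).bddAbove
    have hM' : ∀ n, n₁ ≤ n → n ≤ n₂ → M ≤ a n := fun n p q =>
      hM (Finset.mem_image_of_mem _ (Finset.mem_Icc.2 ⟨p, q⟩))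
    have hN' : ∀ n, n₁ ≤ n → n ≤ n₂ → b n ≤ N := fun n p q =>
      hN (Finset.mem_image_of_mem _ (Finset.mem_Icc.2 ⟨p, q⟩))
    refine ⟨fun n m => H (m, n), (isMorphism_line_prod_iff A H).1 hm,
      ⟨min M (min (a n₁) (a n₂)), fun n m hm => ?_⟩, ⟨max N (max (b n₁) (b n₂)), fun n m hm => ?_⟩,
      ⟨c, fun n hn => funext (hc n hn)⟩, ⟨d, fun n hn => funext (hd n hn)⟩⟩
    · rcases le_total n n₁ with q | q
      · exact (h1 n q m).trans (ha _ _ (by omega))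
      · rcases le_total n n₂ with r | r
        · exact ha _ _ (by have := hM' n q r; omega)
        · exact (h2 n r m).trans (ha _ _ (by omega))
    · rcases le_total n n₁ with q | q
      · exact (h1 n q m).trans (hb _ _ (by omega))
      · rcases le_total n n₂ with r | r
        · exact hb _ _ (by have := hN' n q r; omega)
        · exact (h2 n r m).trans (hb _ _ (by omega))
  · rintro ⟨H, hm, ⟨a, ha⟩, ⟨b, hb⟩, ⟨c, hc⟩, d, hd⟩
    refine ⟨fun z => H z.2 z.1, ⟨(isMorphism_line_prod_iff A _).2 hm, min c d, d, by omega,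
      fun n hn m => ?_, fun n hn m => ?_⟩, fun n => ?_, ⟨c, fun n hn m => congrFun (hc n hn) m⟩,
      ⟨d, fun n hn m => congrFun (hd n hn) m⟩⟩
    · dsimp only
      rw [hd n hn, hd d le_rfl]
    · dsimp only
      rw [hc n (by omega), hc (min c d) (by omega)]
    · have hs : A.IsSeq x x (H n) := by
        refine ⟨fun m => (hm m n).sub _ fun j => ?_, ⟨a, ha n⟩, ⟨b, hb n⟩⟩
        fin_cases j
        · exact ⟨0, rfl⟩
        · exact ⟨1, rfl⟩
      exact ⟨⟨Path.ofSeq _ hs, Path.init_ofSeq _ _, Path.term_ofSeq _ _⟩, fun m => rfl⟩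

instance loopSetoid (A : GlobalAction.{u, v, w} X) (x : X) : Setoid (A.Loop x) where
  r := A.LoopHomotopic x
  iseqv :=
    { refl := fun ω => (loopHomotopic_iff A x ω ω).2 (SeqHomotopic.refl (ω.1.isSeq ω.2.1 ω.2.2))
      symm := fun h => (loopHomotopic_iff A x _ _).2 ((loopHomotopic_iff A x _ _).1 h).symm
      trans := fun h k => (loopHomotopic_iff A x _ _).2
        (((loopHomotopic_iff A x _ _).1 h).trans ((loopHomotopic_iff A x _ _).1 k)) }

/-- The fundamental group: loops at `x` modulo end point stable homotopy. -/
def Pi1 (A : GlobalAction.{u, v, w} X) (x : X) : Type u := Quotient (loopSetoid A x)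

variable {A : GlobalAction.{u, v, w} X} {x : X}

/-- The class of a loop. -/
def Pi1.mk (ω : A.Path) (h : ω.init = x ∧ ω.term = x) : A.Pi1 x := Quotient.mk (loopSetoid A x) ⟨ω, h⟩

theorem Pi1.mk_eq {ω τ : A.Path} {h : ω.init = x ∧ ω.term = x} {h' : τ.init = x ∧ τ.term = x} :
    Pi1.mk ω h = Pi1.mk τ h' ↔ A.SeqHomotopic x x ω τ :=
  Quotient.eq.trans (loopHomotopic_iff A x _ _)

theorem Pi1.ind {P : A.Pi1 x → Prop} (h : ∀ ω hω, P (Pi1.mk ω hω)) (a : A.Pi1 x) : P a :=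
  Quotient.inductionOn a fun ω => h ω.1 ω.2

noncomputable instance : Mul (A.Pi1 x) where
  mul := Quotient.lift₂
    (fun ω τ => Pi1.mk (ω.1.comp τ.1 (ω.2.2.trans τ.2.1.symm))
      ⟨(Path.init_comp _ _ _).trans ω.2.1, (Path.term_comp _ _ _).trans τ.2.2⟩)
    (fun ω τ ω' τ' h k => Pi1.mk_eq.2 (Path.comp_congr _ _ ω.2.1 ω.2.2 τ.2.2 ω'.2.1 ω'.2.2 τ'.2.2
      ((loopHomotopic_iff A x _ _).1 h) ((loopHomotopic_iff A x _ _).1 k)))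

/-- The product of the classes of `ω` and `τ` is the class of the composition, first `ω` and then `τ`. -/
theorem Pi1.mk_mul (ω τ : A.Path) (h : ω.init = x ∧ ω.term = x) (h' : τ.init = x ∧ τ.term = x) :
    Pi1.mk ω h * Pi1.mk τ h' = Pi1.mk (ω.comp τ (h.2.trans h'.1.symm))
      ⟨(Path.init_comp _ _ _).trans h.1, (Path.term_comp _ _ _).trans h'.2⟩ := rfl

instance : One (A.Pi1 x) where
  one := Pi1.mk (Path.const A x) ⟨Path.init_const A x, Path.term_const A x⟩

theorem Pi1.one_def : (1 : A.Pi1 x) = Pi1.mk (Path.const A x) ⟨Path.init_const A x, Path.term_const A x⟩ := rfl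

theorem Pi1.mul_assoc' (a b c : A.Pi1 x) : a * b * c = a * (b * c) := by
  induction a using Pi1.ind with | _ ω hω
  induction b using Pi1.ind with | _ τ hτ
  induction c using Pi1.ind with | _ σ hσ
  simp only [Pi1.mk_mul]
  exact Pi1.mk_eq.2 (Path.comp_assoc _ _ _ _ hω.1 hσ.2)

theorem Pi1.one_mul' (a : A.Pi1 x) : 1 * a = a := by
  induction a using Pi1.ind with | _ ω hω
  rw [Pi1.one_def, Pi1.mk_mul]
  congr 1
  exact Path.const_comp _ (fun _ _ => rfl)

theorem Pi1.mul_one' (a : A.Pi1 x) : a * 1 = a := by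
  induction a using Pi1.ind with | _ ω hω
  rw [Pi1.one_def, Pi1.mk_mul]
  exact Pi1.mk_eq.2 (Path.comp_const _ hω.1 hω.2)

theorem Pi1.mk_inv_mul (ω : A.Path) (h : ω.init = x ∧ ω.term = x) (h' : ω.inv.init = x ∧ ω.inv.term = x) :
    Pi1.mk ω.inv h' * Pi1.mk ω h = 1 := by
  rw [Pi1.mk_mul]
  exact Pi1.mk_eq.2 (Path.inv_comp _ _ h.2)

theorem Pi1.mk_mul_inv (ω : A.Path) (h : ω.init = x ∧ ω.term = x) (h' : ω.inv.init = x ∧ ω.inv.term = x) :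
    Pi1.mk ω h * Pi1.mk ω.inv h' = 1 := by
  rw [Pi1.mk_mul]
  exact Pi1.mk_eq.2 (Path.comp_inv _ _ h.1)

noncomputable instance : Inv (A.Pi1 x) where
  inv := Quotient.lift
    (fun ω => Pi1.mk ω.1.inv ⟨(Path.init_inv _).trans ω.2.2, (Path.term_inv _).trans ω.2.1⟩)
    (by
      intro ω τ h
      have e : Pi1.mk ω.1 ω.2 = Pi1.mk τ.1 τ.2 := Quotient.sound h
      have hω : ω.1.inv.init = x ∧ ω.1.inv.term = x :=
        ⟨(Path.init_inv _).trans ω.2.2, (Path.term_inv _).trans ω.2.1⟩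
      have hτ : τ.1.inv.init = x ∧ τ.1.inv.term = x :=
        ⟨(Path.init_inv _).trans τ.2.2, (Path.term_inv _).trans τ.2.1⟩
      change Pi1.mk ω.1.inv hω = Pi1.mk τ.1.inv hτ
      rw [← Pi1.mul_one' (Pi1.mk ω.1.inv hω), ← Pi1.mk_mul_inv τ.1 τ.2 hτ, ← Pi1.mul_assoc', ← e,
        Pi1.mk_inv_mul, Pi1.one_mul'])

/-- The fundamental group is a group. -/
noncomputable instance : Group (A.Pi1 x) :=
  Group.ofLeftAxioms Pi1.mul_assoc' Pi1.one_mul'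
    (Pi1.ind fun ω hω => Pi1.mk_inv_mul ω hω ⟨(Path.init_inv _).trans hω.2, (Path.term_inv _).trans hω.1⟩)

/-- The homomorphism of fundamental groups induced by a morphism `p` with `p y₀ = x₀`; it sends the class
of `ω` to the class of `p ∘ ω`. -/
noncomputable def Pi1.map {B : GlobalAction.{u₁, v₁, w₁} Y} {p : Y → X} (hp : IsMorphism B A p)
    {y₀ : Y} {x₀ : X} (h₀ : p y₀ = x₀) : B.Pi1 y₀ →* A.Pi1 x₀ :=
  MonoidHom.mk'
    (Quotient.lift
      (fun ω => Pi1.mk (ω.1.map hp) ⟨by rw [Path.init_map, ω.2.1, h₀], by rw [Path.term_map, ω.2.2, h₀]⟩)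
      (by
        intro ω τ h
        refine Pi1.mk_eq.2 ?_
        obtain ⟨H, hm, ⟨a, ha⟩, ⟨b, hb⟩, ⟨c, hc⟩, d, hd⟩ := (loopHomotopic_iff B y₀ _ _).1 h
        refine ⟨fun n m => p (H n m), fun m n => ?_, ⟨a, fun n m hm => ?_⟩, ⟨b, fun n m hm => ?_⟩,
          ⟨c, fun n hn => ?_⟩, ⟨d, fun n hn => ?_⟩⟩
        · refine (hp 3 _ (hm m n)).sub _ fun j => ⟨j, ?_⟩
          fin_cases j <;> rfl
        · dsimp only
          rw [ha n m hm, h₀]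
        · dsimp only
          rw [hb n m hm, h₀]
        · dsimp only
          rw [hc n hn]
          rfl
        · dsimp only
          rw [hd n hn]
          rfl))
    (by
      intro a b
      induction a using Pi1.ind with | _ ω hω
      induction b using Pi1.ind with | _ τ hτ
      rw [Pi1.mk_mul]
      refine Pi1.mk_eq.2 ?_
      dsimp only
      have b1 : ∀ n ≥ ω.lus, ω n = y₀ := fun n hn => hω.2 ▸ ω.eq_term hn
      have c1 : ∀ n ≤ τ.gls, τ n = y₀ := fun n hn => hτ.1 ▸ τ.eq_init hn
      have i : ∀ σ : B.Path, σ.init = y₀ → (σ.map hp).init = x₀ := fun σ h => by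
        rw [Path.init_map, h, h₀]
      have t : ∀ σ : B.Path, σ.term = y₀ → (σ.map hp).term = x₀ := fun σ h => by
        rw [Path.term_map, h, h₀]
      have e1 := Path.comp_seqHomotopic (ω := ω.map hp) (τ := τ.map hp) ((t _ hω.2).trans (i _ hτ.1).symm)
        (i _ hω.1) (t _ hω.2) (t _ hτ.2) (fun n hn => (congrArg p (b1 n hn)).trans h₀)
        (fun n hn => (congrArg p (c1 n hn)).trans h₀)
      refine SeqHomotopic.trans ?_ e1.symm
      obtain ⟨H, hm, ⟨a, ha⟩, ⟨b, hb⟩, ⟨c, hc⟩, d, hd⟩ :=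
        Path.comp_seqHomotopic (hω.2.trans hτ.1.symm) hω.1 hω.2 hτ.2 b1 c1
      refine ⟨fun n m => p (H n m), fun m n => ?_, ⟨a, fun n m hm => ?_⟩, ⟨b, fun n m hm => ?_⟩,
        ⟨c, fun n hn => ?_⟩, ⟨d, fun n hn => ?_⟩⟩
      · refine (hp 3 _ (hm m n)).sub _ fun j => ⟨j, ?_⟩
        fin_cases j <;> rfl
      · dsimp only
        rw [ha n m hm, h₀]
      · dsimp only
        rw [hb n m hm, h₀]
      · dsimp only
        rw [hc n hn]
        rfl
      · dsimp only
        rw [hd n hn]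
        funext m
        unfold glue
        split_ifs <;> rfl)

/-! Classes of paths modulo a subgroup of the fundamental group. -/

/-- The paths with initial point `x₀`. -/
def PathsFrom (A : GlobalAction.{u, v, w} X) (x₀ : X) : Type u := {ω : A.Path // ω.init = x₀}

/-- The class of the loop `τ⁻¹ω` (first `ω`, then the inverse of `τ`). -/
noncomputable def diff {x₀ : X} (ω τ : A.PathsFrom x₀) (h : ω.1.term = τ.1.term) : A.Pi1 x₀ :=
  Pi1.mk (ω.1.comp τ.1.inv (h.trans (Path.init_inv _).symm))
    ⟨(Path.init_comp _ _ _).trans ω.2, (Path.term_comp _ _ _).trans ((Path.term_inv _).trans τ.2)⟩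

/-- Paths `ω`, `τ` from `x₀` are equivalent modulo `H` if they end at the same point and the class of the
loop `τ⁻¹ω` is in `H`. -/
def PathRel {x₀ : X} (H : Subgroup (A.Pi1 x₀)) (ω τ : A.PathsFrom x₀) : Prop :=
  ∃ h : ω.1.term = τ.1.term, diff ω τ h ∈ H

theorem diff_self {x₀ : X} (ω : A.PathsFrom x₀) : diff ω ω rfl = 1 :=
  Pi1.mk_eq.2 (Path.comp_inv _ _ ω.2)

theorem diff_mul_diff {x₀ : X} (ω τ σ : A.PathsFrom x₀) (h : ω.1.term = τ.1.term)
    (h' : τ.1.term = σ.1.term) : diff ω τ h * diff τ σ h' = diff ω σ (h.trans h') := by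
  obtain ⟨ω, hω⟩ := ω
  obtain ⟨τ, hτ⟩ := τ
  obtain ⟨σ, hσ⟩ := σ
  dsimp only at h h'
  unfold diff
  rw [Pi1.mk_mul]
  refine Pi1.mk_eq.2 ?_
  have q1 : ω.term = τ.inv.init := by rw [Path.init_inv, h]
  have q2 : τ.term = σ.inv.init := by rw [Path.init_inv, h']
  have q3 : τ.inv.term = τ.init := Path.term_inv _
  have q4 : ω.term = σ.inv.init := h.trans q2
  have q5 : τ.inv.term = (τ.comp σ.inv q2).init := by rw [Path.init_comp, q3]
  have q6 : (τ.inv.comp τ q3).term = σ.inv.init := by rw [Path.term_comp, q2]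
  have zσ : σ.inv.term = x₀ := (Path.term_inv _).trans hσ
  have sσ : A.IsSeq ω.term x₀ σ.inv := σ.inv.isSeq q4.symm zσ
  have r1 := Path.comp_assoc q1 q5 (by rw [Path.term_comp, q5]) (by rw [Path.init_comp, q1]) hω
    (z := x₀) (by rw [Path.term_comp, zσ])
  have r2 : A.SeqHomotopic ω.term x₀ (τ.inv.comp (τ.comp σ.inv q2) q5) σ.inv := by
    have r3 := Path.comp_assoc q3 q2 q6 q5 (Path.init_inv _) zσ
    have r4 := Path.comp_congr q6 (ω' := Path.const A τ.term) (τ' := σ.inv) ((Path.term_const A _).trans q2)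
      (by rw [Path.init_comp, Path.init_inv]) (Path.term_comp _ _ _) zσ
      (Path.init_const A _) (Path.term_const A _) zσ
      (Path.inv_comp τ q3 rfl) (SeqHomotopic.refl (h ▸ sσ))
    rw [Path.const_comp (ω := Path.const A τ.term) _ (fun _ _ => rfl)] at r4
    rw [h]
    exact r3.symm.trans r4
  exact r1.trans (Path.comp_congr _ q4 hω rfl (by rw [Path.term_comp, Path.term_comp, zσ]) hω rfl zσ
    (SeqHomotopic.refl (ω.isSeq hω rfl)) r2)

theorem diff_symm {x₀ : X} (ω τ : A.PathsFrom x₀) (h : ω.1.term = τ.1.term) :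
    diff τ ω h.symm = (diff ω τ h)⁻¹ :=
  eq_inv_of_mul_eq_one_left ((diff_mul_diff τ ω τ h.symm h).trans (diff_self τ))

/-- Equivalence of paths modulo `H`. -/
def pathSetoid {x₀ : X} (H : Subgroup (A.Pi1 x₀)) : Setoid (A.PathsFrom x₀) where
  r := PathRel H
  iseqv :=
    { refl := fun ω => ⟨rfl, (diff_self ω).symm ▸ H.one_mem⟩
      symm := fun ⟨h, hH⟩ => ⟨h.symm, (diff_symm _ _ h).symm ▸ H.inv_mem hH⟩
      trans := fun ⟨h, hH⟩ ⟨k, kH⟩ => ⟨h.trans k, (diff_mul_diff _ _ _ h k) ▸ H.mul_mem hH kH⟩ }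

/-- The set of classes of paths from `x₀` modulo `H`. -/
def PathClass {x₀ : X} (H : Subgroup (A.Pi1 x₀)) : Type u := Quotient (pathSetoid H)

/-- The class of the constant path at `x₀`. -/
def PathClass.base {x₀ : X} (H : Subgroup (A.Pi1 x₀)) : PathClass H :=
  Quotient.mk (pathSetoid H) ⟨Path.const A x₀, rfl⟩

/-- The terminal point of a class of paths. -/
noncomputable def PathClass.endpoint {x₀ : X} (H : Subgroup (A.Pi1 x₀)) : PathClass H → X :=
  Quotient.lift (fun ω => ω.1.term) (fun _ _ h => h.1)

theorem PathClass.endpoint_base {x₀ : X} (H : Subgroup (A.Pi1 x₀)) :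
    PathClass.endpoint H (PathClass.base H) = x₀ := rfl

end GlobalAction

/-!
The covering action lives on the classes of paths themselves. If `q` is the class of a path ending
at `x` and `x, y` is a local frame, then `q` can be extended by the one-step path from `x` to `y`
(`PathClass.extend`). An element `g` of a local group at `α` acts on the classes with end point in
`A.loc α` by extending a class `q` that ends at `x` to `g • x`. Since `x`, `h • x` and `g • h • x` form
a local frame, the two steps `x, h • x, g • h • x` are homotopic to the single step from `x` to
`g • h • x` (`seqHomotopic_of_frame`), and this is what makes the extension an action
(`PathClass.extend_extend`). The index set, the relation, the groups and the structure homomorphisms are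
those of `A`.

The members of a local frame of this action are determined by one of them and by the end points
(`coverAction_isLocalFrame_iff`), so the end point map is a covering morphism. A path `ω` from `x₀`
lifts to the path of its truncations `n ↦ [ω up to time n]`, which runs from the base class to `[ω]`
(`exists_lift`); hence the action is connected. Since a step from a given class is determined by its end
point, every path from the base class is the lift of its image, and so ends at the class of its image
(`term_eq_of_lift`). Therefore a loop `ω` at `x₀` is the image of a loop at the base class exactly if
`[ω]` is the base class, that is, if the element of the fundamental group given by `ω` lies in `H`
(`PathClass.mk_eq_base_iff`). No lifting of homotopies is needed.
-/

namespace GlobalAction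

variable {X : Type u} {A : GlobalAction.{u, v, w} X}

/-! ### Local frames and one-step paths -/

theorem IsLocalFrame.pair {p : ℕ} {x : Fin (p + 1) → X} (hx : A.IsLocalFrame x) (i j : Fin (p + 1)) :
    A.IsLocalFrame ![x i, x j] :=
  hx.sub _ fun k => by
    fin_cases k
    · exact ⟨i, rfl⟩
    · exact ⟨j, rfl⟩

theorem isLocalFrame_pair_self (x : X) : A.IsLocalFrame ![x, x] :=
  (isLocalFrame_const A (p := 0) x).pair 0 0

theorem isLocalFrame_smul {α : A.Idx} (z : A.loc α) (g h : A.grp α) :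
    A.IsLocalFrame ![(z : X), (g • z : A.loc α), (h • z : A.loc α)] := by
  rw [isLocalFrame_iff]
  refine ⟨α, z, fun i => ?_⟩
  fin_cases i
  · exact ⟨1, by rw [one_smul]; rfl⟩
  · exact ⟨g, rfl⟩
  · exact ⟨h, rfl⟩

theorem isLocalFrame_smul_right {α : A.Idx} {x : X} (hx : x ∈ A.loc α) (g : A.grp α) :
    A.IsLocalFrame ![x, (g • (⟨x, hx⟩ : A.loc α) : A.loc α)] :=
  (isLocalFrame_smul ⟨x, hx⟩ g g).pair 0 1

/-- Sequences with the same ends and with values in a single local frame are homotopic: any change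
between them in a single step is a homotopy. -/
theorem seqHomotopic_of_frame {x y : X} {f g : ℤ → X} (hf : A.IsSeq x y f) (hg : A.IsSeq x y g)
    {p : ℕ} {s : Fin (p + 1) → X} (hs : A.IsLocalFrame s) (hfs : ∀ n, ∃ i, f n = s i)
    (hgs : ∀ n, ∃ i, g n = s i) : A.SeqHomotopic x y f g := by
  obtain ⟨-, ⟨a, ha⟩, b, hb⟩ := hf
  obtain ⟨-, ⟨a', ha'⟩, b', hb'⟩ := hg
  have hv : ∀ n m : ℤ, ∃ i, (if n ≤ 0 then f else g) m = s i := by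
    intro n m
    split_ifs
    · exact hfs m
    · exact hgs m
  refine ⟨fun n => if n ≤ 0 then f else g, fun m n => hs.sub _ fun j => ?_,
    ⟨min a a', fun n m hm => ?_⟩, ⟨max b b', fun n m hm => ?_⟩, ⟨0, fun n hn => if_pos hn⟩,
    ⟨1, fun n hn => if_neg (by omega)⟩⟩
  · fin_cases j
    · exact hv n m
    · exact hv n (m + 1)
    · exact hv (n + 1) m
    · exact hv (n + 1) (m + 1)
  · dsimp only
    split_ifs
    · exact ha m (by omega)
    · exact ha' m (by omega)
  · dsimp only
    split_ifs
    · exact hb m (by omega)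
    · exact hb' m (by omega)

theorem isSeq_step {x y : X} (h : A.IsLocalFrame ![x, y]) :
    A.IsSeq x y (fun n => if n ≤ 0 then x else y) := by
  refine ⟨fun n => h.sub _ fun j => ?_, ⟨0, fun n hn => if_pos hn⟩, ⟨1, fun n hn => if_neg (by omega)⟩⟩
  have hv : ∀ n : ℤ, ∃ i, (if n ≤ 0 then x else y) = ![x, y] i := by
    intro n
    split_ifs
    · exact ⟨0, rfl⟩
    · exact ⟨1, rfl⟩
  fin_cases j
  · exact hv n
  · exact hv (n + 1)

/-- The path that jumps from `x` to `y` between the times `0` and `1`. -/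
def Path.step {x y : X} (h : A.IsLocalFrame ![x, y]) : A.Path := Path.ofSeq _ (isSeq_step h)

theorem Path.init_step {x y : X} (h : A.IsLocalFrame ![x, y]) : (Path.step h).init = x :=
  Path.init_ofSeq _ _

theorem Path.term_step {x y : X} (h : A.IsLocalFrame ![x, y]) : (Path.step h).term = y :=
  Path.term_ofSeq _ _

theorem Path.step_of_nonpos {x y : X} (h : A.IsLocalFrame ![x, y]) {n : ℤ} (hn : n ≤ 0) :
    Path.step h n = x := if_pos hn

theorem Path.step_of_pos {x y : X} (h : A.IsLocalFrame ![x, y]) {n : ℤ} (hn : 0 < n) :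
    Path.step h n = y := if_neg (by omega)

theorem Path.step_comp_step {x y z : X} (h : A.IsLocalFrame ![x, y, z]) (hxy : A.IsLocalFrame ![x, y])
    (hyz : A.IsLocalFrame ![y, z]) (hxz : A.IsLocalFrame ![x, z])
    (e : (Path.step hxy).term = (Path.step hyz).init) :
    A.SeqHomotopic x z ((Path.step hxy).comp (Path.step hyz) e) (Path.step hxz) := by
  have hb : ∀ n ≥ (1 : ℤ), Path.step hxy n = y := fun n hn => Path.step_of_pos hxy (by omega)
  have hc : ∀ n ≤ (0 : ℤ), Path.step hyz n = y := fun n hn => Path.step_of_nonpos hyz hn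
  refine (Path.comp_seqHomotopic e (Path.init_step _) (Path.term_step _) (Path.term_step _) hb hc).trans
    (seqHomotopic_of_frame (isSeq_glue (isSeq_step hxy) (isSeq_step hyz) hb hc)
      (g := fun n => if n ≤ 0 then x else z) (isSeq_step hxz) h
      (fun n => ?_) fun n => ?_)
  · unfold glue Path.step Path.ofSeq
    dsimp only
    split_ifs
    · exact ⟨0, rfl⟩
    · exact ⟨1, rfl⟩
    · exact ⟨1, rfl⟩
    · exact ⟨2, rfl⟩
  · split_ifs
    · exact ⟨0, rfl⟩
    · exact ⟨2, rfl⟩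

/-! ### Classes of paths -/

variable {x₀ : X}

theorem diff_eq_one_of_seqHomotopic {y : X} (ω τ : A.PathsFrom x₀) (hω : ω.1.term = y)
    (hτ : τ.1.term = y) (h : A.SeqHomotopic x₀ y ω.1 τ.1) : diff ω τ (hω.trans hτ.symm) = 1 := by
  have hi : τ.1.inv.init = y := τ.1.init_inv.trans hτ
  have ht : τ.1.inv.term = x₀ := τ.1.term_inv.trans τ.2
  exact Pi1.mk_eq.2 ((Path.comp_congr _ (τ.1.init_inv).symm ω.2 hω ht τ.2 hτ ht h
    (SeqHomotopic.refl (τ.1.inv.isSeq hi ht))).trans (Path.comp_inv _ _ τ.2))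

theorem Path.inv_comp_comp {y z : X} {τ σ : A.Path} (h : τ.term = σ.init)
    (h' : τ.inv.term = (τ.comp σ h).init) (hy : τ.term = y) (hz : σ.term = z) :
    A.SeqHomotopic y z (τ.inv.comp (τ.comp σ h) h') σ := by
  have e : (τ.inv.comp τ τ.term_inv).term = σ.init := (Path.term_comp _ _ _).trans h
  have hσ : A.IsSeq y z σ := σ.isSeq (h.symm.trans hy) hz
  have hi : (τ.inv.comp τ τ.term_inv).init = y := (Path.init_comp _ _ _).trans (τ.init_inv.trans hy)
  have ht : (τ.inv.comp τ τ.term_inv).term = y := (Path.term_comp _ _ _).trans hy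
  have k := Path.comp_congr e (ω' := Path.const A y) (τ' := σ) (hy.symm.trans h) hi ht hz rfl rfl hz
    (Path.inv_comp τ τ.term_inv hy) (SeqHomotopic.refl hσ)
  have hc := Path.const_comp (ω := Path.const A y) (hy.symm.trans h) fun _ _ => rfl
  rw [hc] at k
  exact (Path.comp_assoc τ.term_inv h e h' (τ.init_inv.trans hy) hz).symm.trans k

/-- The loop `(στ)⁻¹(σω)` is homotopic to `τ⁻¹ω`. This makes composition with `σ` compatible with the
equivalence of paths modulo any subgroup of the fundamental group. -/
theorem diff_comp_right (ω τ : A.PathsFrom x₀) (h : ω.1.term = τ.1.term) (σ : A.Path)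
    (hω : ω.1.term = σ.init) (hτ : τ.1.term = σ.init)
    (e : (ω.1.comp σ hω).term = (τ.1.comp σ hτ).term) :
    diff ⟨ω.1.comp σ hω, (Path.init_comp _ _ _).trans ω.2⟩
      ⟨τ.1.comp σ hτ, (Path.init_comp _ _ _).trans τ.2⟩ e = diff ω τ h := by
  obtain ⟨ω, iω⟩ := ω
  obtain ⟨τ, iτ⟩ := τ
  dsimp only at h hω hτ e
  refine Pi1.mk_eq.2 ?_
  dsimp only
  obtain ⟨ρ, hρ⟩ : ∃ ρ, ρ = (τ.comp σ hτ).inv := ⟨_, rfl⟩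
  have iρ : σ.term = ρ.init := by rw [hρ, Path.init_inv, Path.term_comp]
  have tρ : ρ.term = x₀ := by rw [hρ, Path.term_inv, Path.init_comp, iτ]
  have tσρ : (σ.comp ρ iρ).term = x₀ := (Path.term_comp _ _ _).trans tρ
  have q1 : τ.term = (σ.comp ρ iρ).init := hτ.trans (Path.init_comp _ _ _).symm
  have q2 : (τ.comp σ hτ).term = ρ.init := (Path.term_comp _ _ _).trans iρ
  have q3 : τ.inv.term = (τ.comp (σ.comp ρ iρ) q1).init := τ.term_inv.trans (Path.init_comp _ _ _).symm
  have q4 : τ.inv.term = (Path.const A x₀).init := τ.term_inv.trans iτ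
  have ti : τ.inv.term = x₀ := τ.term_inv.trans iτ
  -- The path `ρσ` (first `σ`) is homotopic to `τ⁻¹`, because the loop `ρστ` is contractible.
  have k1 : A.SeqHomotopic x₀ x₀ (τ.comp (σ.comp ρ iρ) q1) (Path.const A x₀) := by
    refine (Path.comp_assoc hτ iρ q2 q1 iτ tρ).symm.trans ?_
    subst hρ
    exact Path.comp_inv _ _ ((Path.init_comp _ _ _).trans iτ)
  have k2 : A.SeqHomotopic τ.term x₀ (σ.comp ρ iρ) τ.inv :=
    ((Path.inv_comp_comp q1 q3 rfl tσρ).symm.trans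
      (Path.comp_congr q3 q4 τ.init_inv ti ((Path.term_comp _ _ _).trans tσρ) τ.init_inv ti rfl
        (SeqHomotopic.refl (τ.inv.isSeq τ.init_inv ti)) k1)).trans
      (Path.comp_const q4 τ.init_inv ti)
  have q5 : ω.term = (σ.comp ρ iρ).init := h.trans q1
  have q6 : (ω.comp σ hω).term = ρ.init := (Path.term_comp _ _ _).trans iρ
  have k3 := (Path.comp_assoc hω iρ q6 q5 iω tρ).trans
    (Path.comp_congr q5 (h.trans τ.init_inv.symm) iω h tσρ iω h ti
      (SeqHomotopic.refl (ω.isSeq iω h)) k2)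
  subst hρ
  exact k3

/-- The class modulo `H` of a path from `x₀`. -/
def PathClass.mk (H : Subgroup (A.Pi1 x₀)) (ω : A.Path) (hω : ω.init = x₀) : PathClass H :=
  Quotient.mk (pathSetoid H) ⟨ω, hω⟩

variable {H : Subgroup (A.Pi1 x₀)}

theorem PathClass.endpoint_mk (ω : A.Path) (hω : ω.init = x₀) :
    PathClass.endpoint H (PathClass.mk H ω hω) = ω.term := rfl

theorem PathClass.ind {P : PathClass H → Prop} (h : ∀ ω hω, P (PathClass.mk H ω hω)) (q : PathClass H) :
    P q :=
  Quotient.inductionOn q fun ω => h ω.1 ω.2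

theorem PathClass.mk_eq_of_seqHomotopic {y : X} {ω τ : A.Path} (hω : ω.init = x₀) (hτ : τ.init = x₀)
    (tω : ω.term = y) (tτ : τ.term = y) (h : A.SeqHomotopic x₀ y ω τ) :
    PathClass.mk H ω hω = PathClass.mk H τ hτ :=
  Quotient.sound ⟨tω.trans tτ.symm, by
    rw [diff_eq_one_of_seqHomotopic ⟨ω, hω⟩ ⟨τ, hτ⟩ tω tτ h]
    exact H.one_mem⟩

/-- A loop represents the base class exactly if its class in the fundamental group lies in `H`. -/
theorem PathClass.mk_eq_base_iff (ω : A.Path) (hω : ω.init = x₀ ∧ ω.term = x₀) :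
    PathClass.mk H ω hω.1 = PathClass.base H ↔ Pi1.mk ω hω ∈ H := by
  have key : ∀ h : ω.term = x₀, diff ⟨ω, hω.1⟩ ⟨Path.const A x₀, rfl⟩ h = Pi1.mk ω hω := by
    intro h
    -- The inverse of a constant path is the constant path by definition.
    exact Pi1.mk_eq.2 (Path.comp_const h hω.1 hω.2)
  constructor
  · intro h
    obtain ⟨h', hH⟩ := Quotient.exact h
    exact key h' ▸ hH
  · intro h
    exact Quotient.sound ⟨hω.2, (key hω.2).symm ▸ h⟩

/-! ### Extending a class of paths by one step -/

open Classical in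
/-- The path `ω` followed by the step from its terminal point to `y`. If these two points do not form a
local frame, then there is no such step, and the value is `ω` itself. -/
noncomputable def PathsFrom.extend (ω : A.PathsFrom x₀) (y : X) : A.PathsFrom x₀ :=
  if h : A.IsLocalFrame ![ω.1.term, y] then
    ⟨ω.1.comp (Path.step h) (Path.init_step h).symm, (Path.init_comp _ _ _).trans ω.2⟩
  else ω

theorem PathsFrom.extend_of_frame (ω : A.PathsFrom x₀) {y : X} (h : A.IsLocalFrame ![ω.1.term, y]) :
    ω.extend y = ⟨ω.1.comp (Path.step h) (Path.init_step h).symm, (Path.init_comp _ _ _).trans ω.2⟩ :=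
  dif_pos h

theorem PathsFrom.extend_of_not_frame (ω : A.PathsFrom x₀) {y : X}
    (h : ¬ A.IsLocalFrame ![ω.1.term, y]) : ω.extend y = ω :=
  dif_neg h

theorem Path.step_congr {x x' y : X} (e : x = x') (h : A.IsLocalFrame ![x, y])
    (h' : A.IsLocalFrame ![x', y]) : Path.step h = Path.step h' := by
  subst e
  rfl

theorem PathsFrom.extend_rel {ω τ : A.PathsFrom x₀} (h : PathRel H ω τ) (y : X) :
    PathRel H (ω.extend y) (τ.extend y) := by
  obtain ⟨e, hH⟩ := h
  by_cases hy : A.IsLocalFrame ![ω.1.term, y]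
  · have hy' : A.IsLocalFrame ![τ.1.term, y] := e ▸ hy
    rw [ω.extend_of_frame hy, τ.extend_of_frame hy']
    have q : ω.1.term = (Path.step hy').init := e.trans (Path.init_step hy').symm
    have h1 := diff_comp_right ω τ e (Path.step hy') q (Path.init_step hy').symm
      ((Path.term_comp _ _ _).trans (Path.term_comp _ _ _).symm)
    rw [← h1] at hH
    simp only [Path.step_congr e hy hy']
    exact ⟨_, hH⟩
  · have hy' : ¬ A.IsLocalFrame ![τ.1.term, y] := e ▸ hy
    rw [ω.extend_of_not_frame hy, τ.extend_of_not_frame hy']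
    exact ⟨e, hH⟩

/-- The extension of a class of paths by a step to `y`. -/
noncomputable def PathClass.extend (q : PathClass H) (y : X) : PathClass H :=
  Quotient.map (sa := pathSetoid H) (sb := pathSetoid H) (fun ω => ω.extend y)
    (fun _ _ h => PathsFrom.extend_rel h y) q

theorem PathClass.extend_mk (ω : A.Path) (hω : ω.init = x₀) {y : X} (h : A.IsLocalFrame ![ω.term, y]) :
    (PathClass.mk H ω hω).extend y = PathClass.mk H (ω.comp (Path.step h) (Path.init_step h).symm)
      ((Path.init_comp _ _ _).trans hω) :=
  congrArg (Quotient.mk (pathSetoid H)) (PathsFrom.extend_of_frame ⟨ω, hω⟩ h)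

theorem PathClass.endpoint_extend (q : PathClass H) {y : X} (h : A.IsLocalFrame ![q.endpoint H, y]) :
    PathClass.endpoint H (q.extend y) = y := by
  induction q using PathClass.ind with | _ ω hω
  rw [PathClass.extend_mk ω hω h]
  exact (Path.term_comp _ _ (Path.init_step h).symm).trans (Path.term_step h)

theorem PathClass.extend_endpoint (q : PathClass H) : q.extend (q.endpoint H) = q := by
  induction q using PathClass.ind with | _ ω hω
  have h : A.IsLocalFrame ![ω.term, ω.term] := isLocalFrame_pair_self ω.term
  rw [PathClass.endpoint_mk, PathClass.extend_mk ω hω h]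
  have e : Path.step h = Path.const A ω.term := Path.ext fun n => ite_self _
  refine PathClass.mk_eq_of_seqHomotopic _ _ ((Path.term_comp _ _ _).trans (Path.term_step h)) rfl ?_
  simp only [e]
  exact Path.comp_const _ hω rfl

/-- Two steps within one local frame have the same effect as a single one. -/
theorem PathClass.extend_extend (q : PathClass H) {y z : X} (h : A.IsLocalFrame ![q.endpoint H, y, z]) :
    (q.extend y).extend z = q.extend z := by
  induction q using PathClass.ind with | _ ω hω
  rw [PathClass.endpoint_mk] at h
  have hxy : A.IsLocalFrame ![ω.term, y] := h.pair 0 1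
  have hyz : A.IsLocalFrame ![y, z] := h.pair 1 2
  have hxz : A.IsLocalFrame ![ω.term, z] := h.pair 0 2
  have ht : (ω.comp (Path.step hxy) (Path.init_step hxy).symm).term = y :=
    (Path.term_comp _ _ _).trans (Path.term_step hxy)
  have hyz' : A.IsLocalFrame ![(ω.comp (Path.step hxy) (Path.init_step hxy).symm).term, z] :=
    ht.symm ▸ hyz
  rw [PathClass.extend_mk ω hω hxy, PathClass.extend_mk _ _ hyz', PathClass.extend_mk ω hω hxz]
  simp only [Path.step_congr ht hyz' hyz]
  have e1 : (Path.step hxy).term = (Path.step hyz).init := (Path.term_step _).trans (Path.init_step _).symm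
  have e2 : ω.term = ((Path.step hxy).comp (Path.step hyz) e1).init :=
    (Path.init_step hxy).symm.trans (Path.init_comp _ _ _).symm
  refine PathClass.mk_eq_of_seqHomotopic _ _ ((Path.term_comp _ _ _).trans (Path.term_step _))
    ((Path.term_comp _ _ _).trans (Path.term_step _))
    ((Path.comp_assoc _ e1 _ e2 hω (Path.term_step _)).trans ?_)
  exact Path.comp_congr _ _ hω rfl ((Path.term_comp _ _ _).trans (Path.term_step _)) hω rfl
    (Path.term_step _) (SeqHomotopic.refl (ω.isSeq hω rfl)) (Path.step_comp_step h hxy hyz hxz e1)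

/-! ### The covering action -/

/-- The global action on the classes of paths: the index set, the groups and the structure
homomorphisms are those of `A`, and `g` sends a class ending at `x` to its extension by the step
from `x` to `g • x`. -/
noncomputable def coverAction (H : Subgroup (A.Pi1 x₀)) : GlobalAction.{u, v, w} (PathClass H) where
  Idx := A.Idx
  rel := A.rel
  rel_refl := A.rel_refl
  grp := A.grp
  group := A.group
  loc α := {q | q.endpoint H ∈ A.loc α}
  act α :=
    { smul := fun g q => ⟨q.1.extend (g • (⟨q.1.endpoint H, q.2⟩ : A.loc α) : A.loc α), by
        change PathClass.endpoint H _ ∈ A.loc α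
        rw [PathClass.endpoint_extend _ (isLocalFrame_smul_right q.2 g)]
        exact Subtype.prop _⟩
      one_smul := by
        rintro ⟨q, hq⟩
        refine Subtype.ext ?_
        change q.extend ((1 : A.grp α) • (⟨q.endpoint H, hq⟩ : A.loc α) : A.loc α) = q
        rw [one_smul, PathClass.extend_endpoint]
      mul_smul := by
        rintro g h ⟨q, hq⟩
        refine Subtype.ext ?_
        have hf := isLocalFrame_smul (⟨q.endpoint H, hq⟩ : A.loc α) h (g * h)
        have he := PathClass.endpoint_extend q (isLocalFrame_smul_right hq h)
        have ht : ∀ (y : X) (hy : y ∈ A.loc α), y = (h • (⟨q.endpoint H, hq⟩ : A.loc α) : A.loc α) →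
            ((g • (⟨y, hy⟩ : A.loc α) : A.loc α) : X) =
              ((g * h) • (⟨q.endpoint H, hq⟩ : A.loc α) : A.loc α) := by
          rintro y hy rfl
          rw [mul_smul]
        change q.extend ((g * h) • (⟨q.endpoint H, hq⟩ : A.loc α) : A.loc α) =
          (q.extend (h • (⟨q.endpoint H, hq⟩ : A.loc α) : A.loc α)).extend
            (g • (⟨PathClass.endpoint H (q.extend (h • (⟨q.endpoint H, hq⟩ : A.loc α) : A.loc α)), _⟩ :
              A.loc α) : A.loc α)
        rw [ht _ _ he]
        exact (PathClass.extend_extend q hf).symm }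
  stable {α β} r g q hq := by
    have h := A.stable r g ⟨q.1.endpoint H, q.2⟩ hq
    rwa [← PathClass.endpoint_extend q.1 (isLocalFrame_smul_right q.2 g)] at h
  hom := A.hom
  hom_smul r g q hq := congrArg q.1.extend (A.hom_smul r g ⟨q.1.endpoint H, q.2⟩ hq)
  hom_refl := A.hom_refl
  cover q := A.cover (q.endpoint H)

/-- A family of classes is a local frame exactly if its end points form one and the members of the family
are the extensions of the first member to these end points. -/
theorem coverAction_isLocalFrame_iff {p : ℕ} (q : Fin (p + 1) → PathClass H) :
    (coverAction H).IsLocalFrame q ↔ A.IsLocalFrame (fun i => (q i).endpoint H) ∧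
      ∀ i, q i = (q 0).extend ((q i).endpoint H) := by
  constructor
  · rintro ⟨(α : A.Idx), (h : ∀ i, (q i).endpoint H ∈ A.loc α), k⟩
    have k' : ∀ i, ∃ g : A.grp α,
        (q 0).extend (g • (⟨(q 0).endpoint H, h 0⟩ : A.loc α) : A.loc α) = q i :=
      fun i => (k i).imp fun _ hg => congrArg Subtype.val hg
    choose g hg using k'
    have he : ∀ i, ((g i • (⟨(q 0).endpoint H, h 0⟩ : A.loc α) : A.loc α) : X) = (q i).endpoint H := by
      intro i
      rw [← hg i, PathClass.endpoint_extend _ (isLocalFrame_smul_right (h 0) (g i))]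
    exact ⟨⟨α, h, fun i => ⟨g i, Subtype.ext (he i)⟩⟩, fun i => he i ▸ (hg i).symm⟩
  · rintro ⟨⟨α, h, k⟩, e⟩
    refine ⟨α, h, fun i => ?_⟩
    obtain ⟨g, hg⟩ := k i
    exact ⟨g, Subtype.ext ((congrArg (q 0).extend (congrArg Subtype.val hg)).trans (e i).symm)⟩

/-- Extending a class to the points of a local frame, whose first point is its end point, gives a
local frame. -/
theorem coverAction_isLocalFrame_extend {p : ℕ} {x : Fin (p + 1) → X} (hx : A.IsLocalFrame x)
    (q : PathClass H) (h₀ : q.endpoint H = x 0) : (coverAction H).IsLocalFrame (fun i => q.extend (x i)) := by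
  have e : ∀ i, PathClass.endpoint H (q.extend (x i)) = x i := fun i =>
    PathClass.endpoint_extend q (h₀.symm ▸ hx.pair 0 i)
  have e₀ : q.extend (x 0) = q := by rw [← h₀, q.extend_endpoint]
  refine (coverAction_isLocalFrame_iff _).2 ⟨?_, fun i => ?_⟩
  · simpa only [e] using hx
  · rw [e, e₀]

theorem isMorphism_endpoint : IsMorphism (coverAction H) A (PathClass.endpoint H) :=
  fun _ q hq => ((coverAction_isLocalFrame_iff q).1 hq).1

theorem isCovering_endpoint : IsCovering (coverAction H) A (PathClass.endpoint H) := by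
  refine ⟨isMorphism_endpoint, fun n x hx q h₀ => ⟨fun i => q.extend (x i),
    ⟨?_, coverAction_isLocalFrame_extend hx q h₀, fun i => ?_⟩, ?_⟩⟩
  · dsimp only
    rw [← h₀, q.extend_endpoint]
  · exact PathClass.endpoint_extend q (h₀.symm ▸ hx.pair 0 i)
  · rintro y ⟨rfl, hy, he⟩
    funext i
    rw [((coverAction_isLocalFrame_iff y).1 hy).2 i, he]

/-! ### Lifts of paths -/

/-- The path `ω` stopped at time `n`. -/
def Path.trunc (ω : A.Path) (n : ℤ) : A.Path where
  toFun m := ω (min m n)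
  isMorphism := (isMorphism_line_iff A _).2 fun m => by
    have h := (isMorphism_line_iff A _).1 ω.isMorphism m
    rcases le_or_gt (m + 1) n with hm | hm
    · rw [min_eq_left hm, min_eq_left (by omega : m ≤ n)]
      exact h
    · rw [min_eq_right hm.le, min_eq_right (by omega : n ≤ m)]
      exact isLocalFrame_pair_self _
  stabLeft := by
    obtain ⟨a, ha⟩ := ω.stabLeft
    refine ⟨min a n, fun m hm => ?_⟩
    rw [ha _ (by omega), ha (min (min a n) n) (by omega)]
  stabRight := ⟨n, fun m hm => congrArg ω.toFun (by omega)⟩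

theorem Path.init_trunc (ω : A.Path) (n : ℤ) : (ω.trunc n).init = ω.init :=
  Path.init_eq (a := ω.gls) _ fun m hm => ω.eq_init (by omega)

theorem Path.term_trunc (ω : A.Path) (n : ℤ) : (ω.trunc n).term = ω n :=
  Path.term_eq (b := n) _ fun m hm => congrArg ω.toFun (by omega)

/-- The class of `ω` stopped at time `n + 1` is the extension of its class at time `n`. -/
theorem PathClass.extend_mk_trunc (ω : A.Path) (hω : ω.init = x₀) (n : ℤ) :
    (PathClass.mk H (ω.trunc n) ((ω.init_trunc n).trans hω)).extend (ω (n + 1)) =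
      PathClass.mk H (ω.trunc (n + 1)) ((ω.init_trunc (n + 1)).trans hω) := by
  have h : A.IsLocalFrame ![(ω.trunc n).term, ω (n + 1)] :=
    (ω.term_trunc n).symm ▸ (isMorphism_line_iff A _).1 ω.isMorphism n
  rw [PathClass.extend_mk _ _ h]
  refine PathClass.mk_eq_of_seqHomotopic _ _ ((Path.term_comp _ _ _).trans (Path.term_step h))
    (ω.term_trunc (n + 1)) ?_
  refine (Path.comp_seqHomotopic (b := n) (c := 0) _ ((ω.init_trunc n).trans hω) rfl (Path.term_step h)
    (fun m hm => ?_) fun m hm => Path.step_of_nonpos h hm).trans ?_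
  · exact (congrArg ω.toFun (by omega : min m n = n)).trans (ω.term_trunc n).symm
  · have e : glue n 0 (ω.trunc n) (Path.step h) = ω.trunc (n + 1) := by
      funext m
      unfold glue
      split_ifs with hm
      · exact congrArg ω.toFun (by omega)
      · exact (Path.step_of_pos h (by omega)).trans (congrArg ω.toFun (by omega))
    rw [e]
    exact SeqHomotopic.refl ((ω.trunc (n + 1)).isSeq ((ω.init_trunc _).trans hω) (ω.term_trunc _))

/-- A path `ω` from `x₀` lifts to the path of its truncations. -/
theorem exists_lift (ω : A.Path) (hω : ω.init = x₀) :
    ∃ σ : (coverAction H).Path, σ.init = PathClass.base H ∧ σ.term = PathClass.mk H ω hω ∧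
      ∀ n, PathClass.endpoint H (σ n) = ω n := by
  have hs : (coverAction H).IsSeq (PathClass.base H) (PathClass.mk H ω hω)
      (fun n => PathClass.mk H (ω.trunc n) ((ω.init_trunc n).trans hω)) := by
    refine ⟨fun n => ?_, ⟨ω.gls, fun n hn => ?_⟩, ⟨ω.lus, fun n hn => ?_⟩⟩
    · have h := (isMorphism_line_iff A _).1 ω.isMorphism n
      refine (coverAction_isLocalFrame_extend h (PathClass.mk H (ω.trunc n) ((ω.init_trunc n).trans hω))
        (ω.term_trunc n)).sub _ fun j => ⟨j, ?_⟩
      fin_cases j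
      · have e := PathClass.extend_endpoint (PathClass.mk H (ω.trunc n) ((ω.init_trunc n).trans hω))
        rw [PathClass.endpoint_mk, ω.term_trunc n] at e
        exact e.symm
      · exact (PathClass.extend_mk_trunc ω hω n).symm
    · have e : ω.trunc n = Path.const A x₀ :=
        Path.ext fun m => (ω.eq_init (by omega)).trans hω
      simp only [e]
      rfl
    · have e : ω.trunc n = ω := Path.ext fun m => by
        change ω (min m n) = ω m
        rcases le_total m n with h | h
        · rw [min_eq_left h]
        · rw [min_eq_right h, ω.eq_term hn, ω.eq_term (hn.trans h)]
      simp only [e]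
  exact ⟨Path.ofSeq _ hs, Path.init_ofSeq _ hs, Path.term_ofSeq _ hs, ω.term_trunc⟩

/-- A path from the base class ends at the class of its image, because it is the lift of its image by
truncations. -/
theorem term_eq_of_lift (σ : (coverAction H).Path) (hσ : σ.init = PathClass.base H)
    (hi : (σ.map isMorphism_endpoint).init = x₀) :
    σ.term = PathClass.mk H (σ.map isMorphism_endpoint) hi := by
  obtain ⟨τ, τi, τt, hτ⟩ := exists_lift (H := H) (σ.map isMorphism_endpoint) hi
  -- Both paths start at the base class, and each of their steps is an extension to the same point.
  have next : ∀ (ρ : (coverAction H).Path) (n : ℤ), ρ (n + 1) = (ρ n).extend ((ρ (n + 1)).endpoint H) :=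
    fun ρ n => ((coverAction_isLocalFrame_iff _).1 ((isMorphism_line_iff _ _).1 ρ.isMorphism n)).2 1
  have start : ∀ n ≤ min σ.gls τ.gls, σ n = τ n := fun n hn => by
    rw [σ.eq_init (by omega), τ.eq_init (by omega), hσ, τi]
  have key : ∀ n, min σ.gls τ.gls ≤ n → σ n = τ n := by
    intro n hn
    induction n, hn using Int.leInduction with
    | base => exact start _ le_rfl
    | succ n _ ih => rw [next σ, next τ, ih, hτ]; rfl
  obtain rfl : σ = τ := Path.ext fun n => (le_total n (min σ.gls τ.gls)).elim (start n) (key n)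
  exact τt

theorem isConnected_coverAction : (coverAction H).IsConnected := by
  intro q r
  have lift : ∀ q : PathClass H, ∃ σ : (coverAction H).Path, σ.init = PathClass.base H ∧ σ.term = q := by
    intro q
    induction q using PathClass.ind with | _ ω hω
    obtain ⟨σ, h, k, -⟩ := exists_lift (H := H) ω hω
    exact ⟨σ, h, k⟩
  obtain ⟨σ, hσ, rfl⟩ := lift q
  obtain ⟨τ, hτ, rfl⟩ := lift r
  exact ⟨σ.inv.comp τ (σ.term_inv.trans (hσ.trans hτ.symm)), (Path.init_comp _ _ _).trans σ.init_inv,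
    Path.term_comp _ _ _⟩

theorem range_map_endpoint :
    (Pi1.map (isMorphism_endpoint (H := H)) (PathClass.endpoint_base H)).range = H := by
  ext a
  constructor
  · rintro ⟨b, rfl⟩
    induction b using Pi1.ind with | _ σ hσ
    have hi : (σ.map isMorphism_endpoint).init = x₀ := by
      rw [Path.init_map, hσ.1, PathClass.endpoint_base]
    have ht : (σ.map isMorphism_endpoint).term = x₀ := by
      rw [Path.term_map, hσ.2, PathClass.endpoint_base]
    exact (PathClass.mk_eq_base_iff _ ⟨hi, ht⟩).1 ((term_eq_of_lift σ hσ.1 hi).symm.trans hσ.2)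
  · intro ha
    induction a using Pi1.ind with | _ ω hω
    obtain ⟨σ, h, k, e⟩ := exists_lift (H := H) ω hω.1
    refine ⟨Pi1.mk σ ⟨h, k.trans ((PathClass.mk_eq_base_iff ω hω).2 ha)⟩, Pi1.mk_eq.2 ?_⟩
    have e' : σ.map isMorphism_endpoint = ω := Path.ext e
    rw [e']
    exact SeqHomotopic.refl (ω.isSeq hω.1 hω.2)

end GlobalAction

theorem theorem4p8 {X : Type u} (A : GlobalAction.{u, v, w} X) (hA : A.IsConnected) (x₀ : X)
    (H : Subgroup (A.Pi1 x₀)) :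
    ∃ (B : GlobalAction.{u, v, w} (GlobalAction.PathClass H))
      (hp : GlobalAction.IsCovering B A (GlobalAction.PathClass.endpoint H)),
      B.IsConnected ∧
        (GlobalAction.Pi1.map hp.1 (GlobalAction.PathClass.endpoint_base H)).range = H :=
  ⟨GlobalAction.coverAction H, GlobalAction.isCovering_endpoint, GlobalAction.isConnected_coverAction,
    GlobalAction.range_map_endpoint⟩
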